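/- Let $P,M,d\in\mathbb N$, $\sigma>0$, $\mu_0\in\mathbb R^P$, $Y=\mu_0+W$ with $W\sim\mathcal N(0,\sigma^2\mathrm{Id}_P)$, let $A\in\mathbb R^{M\times P}$ with adjoint $A^*$, let $\Theta\subseteq\mathbb R^d$ be open, and let $\mu:\mathbb R^P\times\Theta\to\mathbb R^P$. Let $(e_j)$ be the canonical basis of $\mathbb R^P$. Define $$R(\theta)=\mathbb E\|A(\mu(Y,\theta)-\mu_0)\|^2,\qquad \mathrm{DOF}(\theta)=\sum_{i=1}^M\frac{\mathrm{cov}\big((AY)_i,(A\mu(Y,\theta))_i\big)}{\sigma^2},$$ and, for $\varepsilon>0$, $$\widehat{\mathrm{DOF}}(y,\theta,\varepsilon)=\frac1\varepsilon\sum_{j=1}^P\big(A^*A(\mu(y+\varepsilon e_j,\theta)-\mu(y,\theta))\big)_j,$$ $$\mathrm{SURE}(y,\theta,\varepsilon)=\|A(\mu(y,\theta)-y)\|^2-\sigma^2\operatorname{tr}(A^*A)+2\sigma^2\,\widehat{\mathrm{DOF}}(y,\theta,\varepsilon).$$ Weak derivatives on $\Theta$ are understood by integration by parts against $C^1$ functions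 with compact support in $\Theta$. **Theorem (asymptotic unbiasedness of SUGAR).** Assume that there are $L_1,L_2\ge 0$ such that $y\mapsto\mu(y,\theta)$ is $L_1$-Lipschitz and $\mu(0,\theta)=0$ for every $\theta\in\Theta$, and $\theta\mapsto\mu(y,\theta)$ is $L_2$-Lipschitz on $\Theta$ for every $y\in\mathbb R^P$. Then: 1. For every $\theta\in\Theta$, $\mu(Y,\theta)$ is square integrable; $R$ and $\mathrm{DOF}$ are weakly differentiable on $\Theta$. 2. The maps $\mu(y,\cdot)$ have a weak Jacobian: there is a jointly measurable $J(y,\theta)\in\mathbb R^{P\times d}$ such that, for almost every $y$, $J(y,\cdot)$ is a weak Jacobian of $\mu(y,\cdot)$ on $\Theta$. For every such $J$ and every $\varepsilon>0$, for almost every $y$ the functions $\widehat{\mathrm{DOF}}(y,\cdot,\varepsilon)$ and $\mathrm{SURE}(y,\cdot,\varepsilon)$ are weakly differentiable on $\Theta$, with weak gradients $$\nabla_\theta\widehat{\mathrm{DOF}}(y,\theta,\varepsilon)=\frac1\varepsilon\sum_{j=1}^P\big(J(y+\varepsilon e_j,\theta)-J(y,\theta)\big)^*A^*Ae_j,$$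 $$\mathrm{SUGAR}(y,\theta,\varepsilon)=2J(y,\theta)^*A^*A(\mu(y,\theta)-y)+2\sigma^2\nabla_\theta\widehat{\mathrm{DOF}}(y,\theta,\varepsilon).$$ 3. For every such $J$ and all representatives $\nabla R$, $\nabla\mathrm{DOF}$ of the weak gradients of $R$ and $\mathrm{DOF}$, for almost every $\theta\in\Theta$ the random vectors $\mathrm{SUGAR}(Y,\theta,\varepsilon)$ and $\nabla_\theta\widehat{\mathrm{DOF}}(Y,\theta,\varepsilon)$ are integrable for all $\varepsilon>0$ and $$\lim_{\varepsilon\to0^+}\mathbb E\big[\mathrm{SUGAR}(Y,\theta,\varepsilon)\big]=\nabla R(\theta),\qquad \lim_{\varepsilon\to0^+}\mathbb E\big[\nabla_\theta\widehat{\mathrm{DOF}}(Y,\theta,\varepsilon)\big]=\nabla\mathrm{DOF}(\theta).$$ Moreover, at every $\theta\in\Theta$ that is a Lebesgue point of $J(y,\cdot)$ for almost every $y$, the assertion on SUGAR (integrability and limit) holds if $\theta$ is a Lebesgue point of $\nabla R$, and the assertion on $\nabla_\theta\widehat{\mathrm{DOF}}$ holds if $\theta$ is a Lebesgue point of $\nabla\mathrm{DOF}$.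 Here $\theta$ is a Lebesgue point of $g$ if the mean of $\|g-g(\theta)\|$ over the ball of centre $\theta$ and radius $r$ tends to $0$ as $r\to0^+$. -/

import Mathlib

open MeasureTheory ProbabilityTheory Filter Topology
open scoped NNReal ENNReal

namespace Sugar

/-! ### Weak derivatives on an open set of `ℝᵈ` -/

/-- `g` is a weak partial derivative of `f` with respect to the `i`-th variable on `U`:
both are locally integrable on `U`, and integration by parts holds against every `C¹` function
with compact support contained in `U`. -/
def IsWeakPartialDeriv {d : ℕ} (U : Set (EuclideanSpace ℝ (Fin d))) (i : Fin d)
    (f g : EuclideanSpace ℝ (Fin d) → ℝ) : Prop :=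
  LocallyIntegrableOn f U ∧ LocallyIntegrableOn g U ∧
    ∀ φ : EuclideanSpace ℝ (Fin d) → ℝ, ContDiff ℝ 1 φ → HasCompactSupport φ → tsupport φ ⊆ U →
      ∫ x in U, g x * φ x = -∫ x in U, f x * fderiv ℝ φ x (EuclideanSpace.single i 1)

/-- `g` is (a representative of) the weak gradient of the real function `f` on `U`. -/
def IsWeakGradient {d : ℕ} (U : Set (EuclideanSpace ℝ (Fin d)))
    (f : EuclideanSpace ℝ (Fin d) → ℝ)
    (g : EuclideanSpace ℝ (Fin d) → EuclideanSpace ℝ (Fin d)) : Prop :=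
  ∀ i, IsWeakPartialDeriv U i f (fun x => g x i)

/-- `f` is weakly differentiable on `U`. -/
def IsWeaklyDifferentiable {d : ℕ} (U : Set (EuclideanSpace ℝ (Fin d)))
    (f : EuclideanSpace ℝ (Fin d) → ℝ) : Prop :=
  ∃ g, IsWeakGradient U f g

/-- `J` is (a representative of) the weak Jacobian of the vector-valued function `h` on `U`:
the entry `(k, i)` of `J` is the `i`-th weak partial derivative of the `k`-th component. -/
def IsWeakJacobian {d P : ℕ} (U : Set (EuclideanSpace ℝ (Fin d)))
    (h : EuclideanSpace ℝ (Fin d) → EuclideanSpace ℝ (Fin P))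
    (J : EuclideanSpace ℝ (Fin d) →
      (EuclideanSpace ℝ (Fin d) →L[ℝ] EuclideanSpace ℝ (Fin P))) : Prop :=
  ∀ (k : Fin P) (i : Fin d),
    IsWeakPartialDeriv U i (fun x => h x k) (fun x => J x (EuclideanSpace.single i 1) k)

/-- `J` is a jointly (a.e.-)measurable representative of the weak Jacobian of
`θ ↦ μ y θ` on `Θ`, for almost every `y`. -/
structure IsWeakJacobianInParam {d P : ℕ} (Θ : Set (EuclideanSpace ℝ (Fin d)))
    (μ : EuclideanSpace ℝ (Fin P) → EuclideanSpace ℝ (Fin d) → EuclideanSpace ℝ (Fin P))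
    (J : EuclideanSpace ℝ (Fin P) → EuclideanSpace ℝ (Fin d) →
      (EuclideanSpace ℝ (Fin d) →L[ℝ] EuclideanSpace ℝ (Fin P))) : Prop where
  aestronglyMeasurable : AEStronglyMeasurable (Function.uncurry J)
    ((volume : Measure (EuclideanSpace ℝ (Fin P))).prod (volume.restrict Θ))
  isWeakJacobian : ∀ᵐ y, IsWeakJacobian Θ (μ y) (J y)

/-- `θ` is a Lebesgue point of `g`: the mean of `‖g - g θ‖` over the ball of radius `r` centred
at `θ` tends to `0` as `r` decreases to `0`. -/
def IsLebesguePoint {d : ℕ} {F : Type*} [NormedAddCommGroup F]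
    (g : EuclideanSpace ℝ (Fin d) → F) (θ : EuclideanSpace ℝ (Fin d)) : Prop :=
  Tendsto (fun r : ℝ => ⨍ x in Metric.closedBall θ r, ‖g x - g θ‖) (𝓝[>] 0) (𝓝 0)

/-! ### Risk, degrees of freedom, and their estimators

The observation is `Y = μ₀ + W`; `A` is an `M × P` matrix, seen as a linear map. -/

/-- The quadratic risk `E_W ‖A (μ(Y, θ) - μ₀)‖²`. -/
noncomputable def risk {Ω : Type*} [MeasurableSpace Ω] (Pr : Measure Ω) {P M d : ℕ}
    (W : Ω → EuclideanSpace ℝ (Fin P))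
    (A : EuclideanSpace ℝ (Fin P) →L[ℝ] EuclideanSpace ℝ (Fin M))
    (μ : EuclideanSpace ℝ (Fin P) → EuclideanSpace ℝ (Fin d) → EuclideanSpace ℝ (Fin P))
    (μ₀ : EuclideanSpace ℝ (Fin P)) (θ : EuclideanSpace ℝ (Fin d)) : ℝ :=
  ∫ ω, ‖A (μ (μ₀ + W ω) θ - μ₀)‖ ^ 2 ∂Pr

/-- The degrees of freedom `∑ i, cov((A Y)ᵢ, (A μ(Y, θ))ᵢ) / σ²`. -/
noncomputable def dof {Ω : Type*} [MeasurableSpace Ω] (Pr : Measure Ω) {P M d : ℕ}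
    (W : Ω → EuclideanSpace ℝ (Fin P)) (σ : ℝ)
    (A : EuclideanSpace ℝ (Fin P) →L[ℝ] EuclideanSpace ℝ (Fin M))
    (μ : EuclideanSpace ℝ (Fin P) → EuclideanSpace ℝ (Fin d) → EuclideanSpace ℝ (Fin P))
    (μ₀ : EuclideanSpace ℝ (Fin P)) (θ : EuclideanSpace ℝ (Fin d)) : ℝ :=
  ∑ i : Fin M, cov[fun ω => A (μ₀ + W ω) i, fun ω => A (μ (μ₀ + W ω) θ) i; Pr] / σ ^ 2

/-- The finite-difference DOF estimator
`(1/ε) ∑ j, (A* A (μ(y + ε eⱼ, θ) - μ(y, θ)))ⱼ`. -/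
noncomputable def dofFD {P M d : ℕ}
    (A : EuclideanSpace ℝ (Fin P) →L[ℝ] EuclideanSpace ℝ (Fin M))
    (μ : EuclideanSpace ℝ (Fin P) → EuclideanSpace ℝ (Fin d) → EuclideanSpace ℝ (Fin P))
    (y : EuclideanSpace ℝ (Fin P)) (θ : EuclideanSpace ℝ (Fin d)) (ε : ℝ) : ℝ :=
  (1 / ε) * ∑ j : Fin P,
    (ContinuousLinearMap.adjoint A) (A (μ (y + ε • EuclideanSpace.single j 1) θ - μ y θ)) j

/-- The finite-difference SURE
`‖A (μ(y, θ) - y)‖² - σ² tr(A* A) + 2 σ² dofFD(y, θ, ε)`. -/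
noncomputable def sureFD {P M d : ℕ} (σ : ℝ)
    (A : EuclideanSpace ℝ (Fin P) →L[ℝ] EuclideanSpace ℝ (Fin M))
    (μ : EuclideanSpace ℝ (Fin P) → EuclideanSpace ℝ (Fin d) → EuclideanSpace ℝ (Fin P))
    (y : EuclideanSpace ℝ (Fin P)) (θ : EuclideanSpace ℝ (Fin d)) (ε : ℝ) : ℝ :=
  ‖A (μ y θ - y)‖ ^ 2
    - σ ^ 2 * LinearMap.trace ℝ (EuclideanSpace ℝ (Fin P))
        ((ContinuousLinearMap.adjoint A) ∘L A).toLinearMap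
    + 2 * σ ^ 2 * dofFD A μ y θ ε

/-- The weak gradient in `θ` of `dofFD`, in terms of the weak Jacobian `J` of `μ` in `θ`:
`(1/ε) ∑ j, (J(y + ε eⱼ, θ) - J(y, θ))* A* A eⱼ`. -/
noncomputable def gradDofFD {P M d : ℕ}
    (A : EuclideanSpace ℝ (Fin P) →L[ℝ] EuclideanSpace ℝ (Fin M))
    (J : EuclideanSpace ℝ (Fin P) → EuclideanSpace ℝ (Fin d) →
      (EuclideanSpace ℝ (Fin d) →L[ℝ] EuclideanSpace ℝ (Fin P)))
    (y : EuclideanSpace ℝ (Fin P)) (θ : EuclideanSpace ℝ (Fin d)) (ε : ℝ) :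
    EuclideanSpace ℝ (Fin d) :=
  (1 / ε) • ∑ j : Fin P,
    ContinuousLinearMap.adjoint (J (y + ε • EuclideanSpace.single j 1) θ - J y θ)
      (ContinuousLinearMap.adjoint A (A (EuclideanSpace.single j 1)))

/-- The Stein Unbiased GrAdient estimator of the Risk, i.e. the weak gradient in `θ` of `sureFD`:
`2 J(y, θ)* A* A (μ(y, θ) - y) + 2 σ² gradDofFD(y, θ, ε)`. -/
noncomputable def sugar {P M d : ℕ} (σ : ℝ)
    (A : EuclideanSpace ℝ (Fin P) →L[ℝ] EuclideanSpace ℝ (Fin M))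
    (μ : EuclideanSpace ℝ (Fin P) → EuclideanSpace ℝ (Fin d) → EuclideanSpace ℝ (Fin P))
    (J : EuclideanSpace ℝ (Fin P) → EuclideanSpace ℝ (Fin d) →
      (EuclideanSpace ℝ (Fin d) →L[ℝ] EuclideanSpace ℝ (Fin P)))
    (y : EuclideanSpace ℝ (Fin P)) (θ : EuclideanSpace ℝ (Fin d)) (ε : ℝ) :
    EuclideanSpace ℝ (Fin d) :=
  (2 : ℝ) • ContinuousLinearMap.adjoint (J y θ) (ContinuousLinearMap.adjoint A (A (μ y θ - y)))
    + (2 * σ ^ 2) • gradDofFD A J y θ ε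

/-- `F ε` is integrable for every `ε > 0` and its expectation tends to `v` as `ε → 0`, `ε > 0`. -/
def ExpectationTendsTo {Ω : Type*} [MeasurableSpace Ω] (Pr : Measure Ω) {d : ℕ}
    (F : ℝ → Ω → EuclideanSpace ℝ (Fin d)) (v : EuclideanSpace ℝ (Fin d)) : Prop :=
  (∀ ε : ℝ, 0 < ε → Integrable (F ε) Pr) ∧
    Tendsto (fun ε : ℝ => ∫ ω, F ε ω ∂Pr) (𝓝[>] 0) (𝓝 v)

end Sugar

/-! The engine is Stein's identity with the derivative thrown onto the Gaussian density. For h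
bounded and measurable, E[h(Y + εe) - h(Y)]/ε tends to σ⁻² E[⟨Y - μ₀, e⟩ h(Y)]: translate the
variable, then differentiate the density (`tendsto_integral_obsLaw_translate`). No regularity of h
is used, so h may be y ↦ J(y,θ)* A*A eⱼ. Summing over j, the mean of the finite-difference gradient
tends to σ⁻² E[J* A*A (Y - μ₀)]. Adding 2 E[J* A*A (μ - Y)] to 2σ² times this cancels Y, so the mean
of SUGAR tends to 2 E[J* A*A (μ - μ₀)].

These limits are the weak gradients of DOF and R. Over Θ, `μ` coincides with a jointly Lipschitz map
m on the whole space (`exists_lipschitzWith_extension`). By Rademacher's theorem the derivative of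
m(y, ·) exists almost everywhere; it is bounded, jointly measurable and a weak Jacobian. The
integrands of R and DOF are locally Lipschitz in θ and dominated by an integrable function of y, so
weak gradients pass under the expectation (`isWeakGradient_integral`).

It remains to treat arbitrary representatives. Uniqueness of weak derivatives and Fubini give J =
`fderiv` for almost every θ, then almost every y. At a prescribed Lebesgue point, J(y,θ) is instead
the limit of ball means of `fderiv`, which makes it measurable in y and bounded. Averaging the weak
gradient over small balls, exchanging with the expectation and using dominated convergence then
gives its value there in terms of J(y,θ) (`eq_integral_of_isLebesguePoint`). -/

namespace Sugar

/-! ### Gaussian density and integration by parts -/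

section Gaussian

variable {E : Type*} [NormedAddCommGroup E] [InnerProductSpace ℝ E] [FiniteDimensional ℝ E]
  [MeasurableSpace E] [BorelSpace E]

lemma integrable_exp_neg_mul_sq_norm {b : ℝ} (hb : 0 < b) :
    Integrable (fun x : E => Real.exp (-b * ‖x‖ ^ 2)) := by
  have h := (GaussianFourier.integrable_cexp_neg_mul_sq_norm_add (V := E) (b := (b : ℂ))
    (by simpa using hb) 0 0).re
  refine h.congr (Eventually.of_forall fun x => ?_)
  simp only [zero_mul, add_zero, RCLike.re_to_complex]
  rw [← Complex.exp_ofReal_re]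
  push_cast
  rfl

lemma integral_exp_neg_mul_sq_norm_pos {b : ℝ} (hb : 0 < b) :
    0 < ∫ x : E, Real.exp (-b * ‖x‖ ^ 2) :=
  integral_exp_pos (integrable_exp_neg_mul_sq_norm hb)

/-- The density of the centred Gaussian vector with independent coordinates of variance
`1 / (2 b)`. -/
noncomputable def gaussDensity (E : Type*) [NormedAddCommGroup E] [InnerProductSpace ℝ E]
    [FiniteDimensional ℝ E] [MeasurableSpace E] [BorelSpace E] (b : ℝ) (x : E) : ℝ :=
  (∫ x : E, Real.exp (-b * ‖x‖ ^ 2))⁻¹ * Real.exp (-b * ‖x‖ ^ 2)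

lemma gaussDensity_pos {b : ℝ} (hb : 0 < b) (x : E) : 0 < gaussDensity E b x :=
  mul_pos (inv_pos.2 (integral_exp_neg_mul_sq_norm_pos hb)) (Real.exp_pos _)

@[fun_prop]
lemma continuous_gaussDensity {b : ℝ} : Continuous (gaussDensity E b) := by
  unfold gaussDensity
  fun_prop

lemma integrable_gaussDensity {b : ℝ} (hb : 0 < b) : Integrable (gaussDensity E b) :=
  (integrable_exp_neg_mul_sq_norm hb).const_mul _

lemma charFun_withDensity_gaussDensity {b : ℝ} (hb : 0 < b) (t : E) :
    charFun (volume.withDensity fun x : E => ENNReal.ofReal (gaussDensity E b x)) t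
      = Complex.exp (-(‖t‖ ^ 2 / (4 * b) : ℝ)) := by
  rw [charFun_apply, integral_withDensity_eq_integral_toReal_smul (by fun_prop) (by simp)]
  have hb' : 0 < (b : ℂ).re := by simpa using hb
  -- One Fourier integral serves twice: with zero linear term it gives the normalising constant,
  -- with linear term i⟨t, x⟩ the numerator.
  have h0 := GaussianFourier.integral_cexp_neg_mul_sq_norm_add (V := E) hb' 0 0
  have h1 := GaussianFourier.integral_cexp_neg_mul_sq_norm_add (V := E) hb' Complex.I t
  have hZ : ((∫ x : E, Real.exp (-b * ‖x‖ ^ 2) : ℝ) : ℂ)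
      = (Real.pi / b : ℂ) ^ (Module.finrank ℝ E / 2 : ℂ) := by
    rw [← integral_complex_ofReal]
    simpa using h0
  have hne : ((∫ x : E, Real.exp (-b * ‖x‖ ^ 2) : ℝ) : ℂ) ≠ 0 := by
    exact_mod_cast (integral_exp_neg_mul_sq_norm_pos (E := E) hb).ne'
  have : ∀ x : E, (ENNReal.ofReal (gaussDensity E b x)).toReal
        • Complex.exp ((inner ℝ x t : ℝ) * Complex.I)
      = ((∫ x : E, Real.exp (-b * ‖x‖ ^ 2) : ℝ) : ℂ)⁻¹
        * Complex.exp (-b * ‖x‖ ^ 2 + Complex.I * (inner ℝ t x : ℝ)) := by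
    intro x
    rw [ENNReal.toReal_ofReal (gaussDensity_pos hb x).le, gaussDensity, Complex.real_smul,
      Complex.exp_add, real_inner_comm, mul_comm Complex.I]
    push_cast
    ring
  simp_rw [this]
  rw [integral_const_mul, h1, ← hZ, ← mul_assoc, inv_mul_cancel₀ hne, one_mul]
  congr 1
  push_cast
  rw [Complex.I_sq]
  ring

lemma isFiniteMeasure_withDensity_gaussDensity {b : ℝ} (hb : 0 < b) :
    IsFiniteMeasure (volume.withDensity fun x : E => ENNReal.ofReal (gaussDensity E b x)) :=
  isFiniteMeasure_withDensity_ofReal (integrable_gaussDensity hb).2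

/-- Both sides have characteristic function exp(-σ²‖t‖²/2). The explicit density is what can be
translated and differentiated. -/
lemma multivariateGaussian_eq_withDensity {P : ℕ} {σ : ℝ} (hσ : 0 < σ) :
    multivariateGaussian 0 (σ ^ 2 • (1 : Matrix (Fin P) (Fin P) ℝ))
      = volume.withDensity
        fun x => ENNReal.ofReal (gaussDensity (EuclideanSpace ℝ (Fin P)) (1 / (2 * σ ^ 2)) x) := by
  have hb : 0 < 1 / (2 * σ ^ 2) := by positivity
  have := isFiniteMeasure_withDensity_gaussDensity (E := EuclideanSpace ℝ (Fin P)) hb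
  refine Measure.ext_of_charFun (funext fun t => ?_)
  rw [charFun_withDensity_gaussDensity hb,
    charFun_multivariateGaussian (Matrix.PosSemidef.one.smul (sq_nonneg σ))]
  congr 1
  simp only [inner_zero_right, Complex.ofReal_zero, zero_mul, zero_sub, Matrix.smul_mulVec,
    Matrix.one_mulVec, EuclideanSpace.norm_sq_eq, Real.norm_eq_abs, sq_abs,
    dotProduct, Pi.smul_apply, smul_eq_mul]
  push_cast
  field_simp
  rw [← Finset.sum_mul]
  ring

omit [FiniteDimensional ℝ E] [MeasurableSpace E] [BorelSpace E] in
-- An integrable bound, uniform in |s| ≤ 1, for the derivative of the translated density. Half of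
-- the exponent absorbs the factor ‖x - s e‖; then ‖x‖² ≤ 2‖x - s e‖² + 2‖e‖² turns the remaining
-- b/2 into b/4 and removes s.
lemma mul_exp_neg_mul_sq_le {b : ℝ} (hb : 0 < b) (x e : E) {s : ℝ} (hs : |s| ≤ 1) :
    ‖x - s • e‖ * Real.exp (-b * ‖x - s • e‖ ^ 2)
      ≤ ((1 + 2 / b) * Real.exp (b / 2 * ‖e‖ ^ 2)) * Real.exp (-(b / 4) * ‖x‖ ^ 2) := by
  set t := ‖x - s • e‖
  have ht : 0 ≤ t := norm_nonneg _
  have h1 : t ≤ (1 + 2 / b) * Real.exp (b / 2 * t ^ 2) := by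
    have h2 := Real.add_one_le_exp (b / 2 * t ^ 2)
    have h3 : 1 ≤ Real.exp (b / 2 * t ^ 2) := Real.one_le_exp (by positivity)
    have h4 : t ^ 2 ≤ 2 / b * Real.exp (b / 2 * t ^ 2) := by
      rw [div_mul_eq_mul_div, le_div_iff₀ hb]
      linarith
    nlinarith [sq_nonneg (t - 1)]
  have h5 : ‖x‖ ^ 2 ≤ 2 * t ^ 2 + 2 * ‖e‖ ^ 2 := by
    have h6 : ‖x‖ ≤ t + ‖e‖ := by
      calc ‖x‖ = ‖(x - s • e) + s • e‖ := by rw [sub_add_cancel]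
        _ ≤ t + ‖s • e‖ := norm_add_le _ _
        _ ≤ t + ‖e‖ := by
          rw [norm_smul, Real.norm_eq_abs]
          nlinarith [norm_nonneg e]
    nlinarith [norm_nonneg x, norm_nonneg e, sq_nonneg (t - ‖e‖)]
  calc t * Real.exp (-b * t ^ 2)
      ≤ (1 + 2 / b) * Real.exp (b / 2 * t ^ 2) * Real.exp (-b * t ^ 2) := by gcongr
    _ = (1 + 2 / b) * Real.exp (-(b / 2) * t ^ 2) := by
      rw [mul_assoc, ← Real.exp_add]
      ring_nf
    _ ≤ (1 + 2 / b) * Real.exp (b / 2 * ‖e‖ ^ 2 + -(b / 4) * ‖x‖ ^ 2) := by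
      gcongr
      nlinarith
    _ = _ := by rw [Real.exp_add, mul_assoc]

variable {F : Type*} [NormedAddCommGroup F] [NormedSpace ℝ F]

lemma integral_withDensity_gaussDensity {b : ℝ} (hb : 0 < b) (h : E → F) :
    ∫ x, h x ∂(volume.withDensity fun x : E => ENNReal.ofReal (gaussDensity E b x))
      = ∫ x, gaussDensity E b x • h x := by
  rw [integral_withDensity_eq_integral_toReal_smul (by fun_prop) (by simp)]
  simp_rw [ENNReal.toReal_ofReal (gaussDensity_pos hb _).le]

/-- Gaussian integration by parts, with the derivative left as a difference quotient. -/
lemma hasDerivAt_integral_gaussian_translate {b : ℝ} (hb : 0 < b) {h : E → F}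
    (hm : AEStronglyMeasurable h) {C : ℝ} (hC : ∀ᵐ x, ‖h x‖ ≤ C) (e : E) :
    HasDerivAt (fun s : ℝ => ∫ x, h (x + s • e)
        ∂(volume.withDensity fun x : E => ENNReal.ofReal (gaussDensity E b x)))
      (∫ x, (2 * b * inner ℝ x e) • h x
        ∂(volume.withDensity fun x : E => ENNReal.ofReal (gaussDensity E b x))) 0 := by
  simp_rw [integral_withDensity_gaussDensity hb]
  -- Translation invariance of Lebesgue measure moves s from `h`, which is merely measurable, to the
  -- smooth density.
  have hshift : ∀ s : ℝ, ∫ x, gaussDensity E b x • h (x + s • e)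
      = ∫ x, gaussDensity E b (x - s • e) • h x := fun s => by
    simpa using integral_add_right_eq_self
      (fun x => gaussDensity E b (x - s • e) • h x) (s • e)
  simp_rw [hshift]
  have key := hasDerivAt_integral_of_dominated_loc_of_deriv_le
    (μ := (volume : Measure E)) (𝕜 := ℝ) (x₀ := (0 : ℝ)) (s := Metric.ball 0 1)
    (F := fun s x => gaussDensity E b (x - s • e) • h x)
    (F' := fun s x => (2 * b * inner ℝ (x - s • e) e * gaussDensity E b (x - s • e)) • h x)
    (bound := fun x => (2 * b * ‖e‖ * (∫ x : E, Real.exp (-b * ‖x‖ ^ 2))⁻¹ *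
      ((1 + 2 / b) * Real.exp (b / 2 * ‖e‖ ^ 2)) * max C 0) * Real.exp (-(b / 4) * ‖x‖ ^ 2))
    (Metric.ball_mem_nhds _ one_pos)
    (Eventually.of_forall fun s => by
      refine AEStronglyMeasurable.smul ?_ hm
      exact Continuous.aestronglyMeasurable (by fun_prop))
    ?_ ?_ ?_ ((integrable_exp_neg_mul_sq_norm (by positivity)).const_mul _) ?_
  · refine key.2.congr_deriv (integral_congr_ae (Eventually.of_forall fun x => ?_))
    simp only [zero_smul, sub_zero, smul_smul]
    rw [mul_comm]
  · simp only [zero_smul, sub_zero]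
    exact (integrable_gaussDensity hb).smul_bdd _ hm hC
  · refine AEStronglyMeasurable.smul ?_ hm
    exact Continuous.aestronglyMeasurable (by fun_prop)
  · filter_upwards [hC] with x hx s hs
    have hs' : |s| ≤ 1 := by simpa using (mem_ball_zero_iff.1 hs).le
    have h1 := mul_exp_neg_mul_sq_le hb x e hs'
    have hZ := (inv_pos.2 (integral_exp_neg_mul_sq_norm_pos (E := E) hb)).le
    rw [norm_smul, norm_mul, norm_mul, Real.norm_of_nonneg (gaussDensity_pos hb _).le,
      Real.norm_of_nonneg (by positivity : 0 ≤ 2 * b), Real.norm_eq_abs]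
    calc 2 * b * |inner ℝ (x - s • e) e| * gaussDensity E b (x - s • e) * ‖h x‖
        ≤ 2 * b * (‖x - s • e‖ * ‖e‖) * gaussDensity E b (x - s • e) * max C 0 := by
          have := (gaussDensity_pos hb (x - s • e)).le
          gcongr
          · exact abs_real_inner_le_norm _ _
          · exact hx.trans (le_max_left _ _)
      _ = 2 * b * ‖e‖ * (∫ x : E, Real.exp (-b * ‖x‖ ^ 2))⁻¹ *
          (‖x - s • e‖ * Real.exp (-b * ‖x - s • e‖ ^ 2)) * max C 0 := by
          rw [gaussDensity]; ring
      _ ≤ 2 * b * ‖e‖ * (∫ x : E, Real.exp (-b * ‖x‖ ^ 2))⁻¹ *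
          (((1 + 2 / b) * Real.exp (b / 2 * ‖e‖ ^ 2)) * Real.exp (-(b / 4) * ‖x‖ ^ 2))
            * max C 0 := by gcongr
      _ = _ := by ring
  · refine Eventually.of_forall fun x s _ => HasDerivAt.smul_const ?_ (h x)
    have h1 : HasDerivAt (fun s : ℝ => x - s • e) (-e) s := by
      simpa using ((hasDerivAt_id s).smul_const e).const_sub x
    have h2 := ((h1.norm_sq.const_mul (-b)).exp).const_mul
      (∫ x : E, Real.exp (-b * ‖x‖ ^ 2))⁻¹
    refine h2.congr_deriv ?_
    rw [gaussDensity, inner_neg_right]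
    ring

end Gaussian

/-! ### Weak derivatives: uniqueness, locally Lipschitz functions, integrals with a parameter -/

section WeakDerivative

variable {d : ℕ} {U : Set (EuclideanSpace ℝ (Fin d))}

lemma IsWeakPartialDeriv.congr {f f' g g' : EuclideanSpace ℝ (Fin d) → ℝ} {i : Fin d}
    (h : IsWeakPartialDeriv U i f g) (hf : f =ᵐ[volume.restrict U] f')
    (hg : g =ᵐ[volume.restrict U] g') : IsWeakPartialDeriv U i f' g' := by
  obtain ⟨h1, h2, h3⟩ := h
  refine ⟨h1.congr hf, h2.congr hg, fun φ hφ hc hs => ?_⟩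
  have e1 : ∫ x in U, g' x * φ x = ∫ x in U, g x * φ x :=
    integral_congr_ae (hg.mono fun x hx => by simp only [hx])
  have e2 : ∫ x in U, f' x * fderiv ℝ φ x (EuclideanSpace.single i 1)
      = ∫ x in U, f x * fderiv ℝ φ x (EuclideanSpace.single i 1) :=
    integral_congr_ae (hf.mono fun x hx => by simp only [hx])
  rw [e1, e2, h3 φ hφ hc hs]

lemma IsWeakGradient.congr {f f' : EuclideanSpace ℝ (Fin d) → ℝ}
    {g g' : EuclideanSpace ℝ (Fin d) → EuclideanSpace ℝ (Fin d)}
    (h : IsWeakGradient U f g) (hf : f =ᵐ[volume.restrict U] f')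
    (hg : g =ᵐ[volume.restrict U] g') : IsWeakGradient U f' g' :=
  fun i => (h i).congr hf (hg.mono fun x hx => by simp only [hx])

lemma integrable_mul_of_locallyIntegrableOn {f φ : EuclideanSpace ℝ (Fin d) → ℝ}
    (hf : LocallyIntegrableOn f U) (hφ : Continuous φ) (hc : HasCompactSupport φ)
    (hs : tsupport φ ⊆ U) : IntegrableOn (fun x => f x * φ x) U := by
  have h1 : IntegrableOn (fun x => f x * φ x) (tsupport φ) :=
    (hf.integrableOn_compact_subset hs hc).mul_continuousOn hφ.continuousOn hc
  have h2 : Integrable (fun x => f x * φ x) :=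
    (integrableOn_iff_integrable_of_support_subset fun x hx =>
      subset_tsupport φ (right_ne_zero_of_mul hx)).1 h1
  exact h2.integrableOn

/-- Fundamental lemma of the calculus of variations: `g - g'` integrates to zero against every
smooth test function supported in `U`, smooth ones being among the `C¹` ones. -/
lemma IsWeakPartialDeriv.ae_eq (hU : IsOpen U) {i : Fin d}
    {f g g' : EuclideanSpace ℝ (Fin d) → ℝ}
    (h : IsWeakPartialDeriv U i f g) (h' : IsWeakPartialDeriv U i f g') :
    g =ᵐ[volume.restrict U] g' := by
  have key := hU.ae_eq_zero_of_integral_contDiff_smul_eq_zero (μ := volume) (h.2.1.sub h'.2.1)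
    fun φ hφ hc hs => by
      have hφ1 : ContDiff ℝ 1 φ := hφ.of_le (by exact_mod_cast le_top)
      have e : ∫ x in U, φ x • (g - g') x = 0 := by
        have : ∀ x, φ x • (g - g') x = g x * φ x - g' x * φ x := fun x => by
          simp only [Pi.sub_apply, smul_eq_mul]
          ring
        simp_rw [this]
        rw [integral_sub (integrable_mul_of_locallyIntegrableOn h.2.1 hφ1.continuous hc hs)
          (integrable_mul_of_locallyIntegrableOn h'.2.1 hφ1.continuous hc hs),
          h.2.2 φ hφ1 hc hs, h'.2.2 φ hφ1 hc hs, sub_self]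
      rw [← e, setIntegral_eq_integral_of_forall_compl_eq_zero]
      intro x hx
      rw [image_eq_zero_of_notMem_tsupport fun hx' => hx (hs hx'), zero_smul]
  rw [Filter.EventuallyEq, ae_restrict_iff' hU.measurableSet]
  filter_upwards [key] with x hx hxU
  exact sub_eq_zero.1 (hx hxU)

lemma IsWeakGradient.ae_eq (hU : IsOpen U) {f : EuclideanSpace ℝ (Fin d) → ℝ}
    {g g' : EuclideanSpace ℝ (Fin d) → EuclideanSpace ℝ (Fin d)}
    (h : IsWeakGradient U f g) (h' : IsWeakGradient U f g') :
    g =ᵐ[volume.restrict U] g' := by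
  filter_upwards [ae_all_iff.2 fun i => (h i).ae_eq hU (h' i)] with x hx
  ext i
  exact hx i

lemma IsWeakJacobian.ae_eq {P : ℕ} (hU : IsOpen U)
    {f : EuclideanSpace ℝ (Fin d) → EuclideanSpace ℝ (Fin P)}
    {J J' : EuclideanSpace ℝ (Fin d) → (EuclideanSpace ℝ (Fin d) →L[ℝ] EuclideanSpace ℝ (Fin P))}
    (h : IsWeakJacobian U f J) (h' : IsWeakJacobian U f J') :
    J =ᵐ[volume.restrict U] J' := by
  filter_upwards [ae_all_iff.2 fun k => ae_all_iff.2 fun i => (h k i).ae_eq hU (h' k i)] with x hx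
  refine (ContinuousLinearMap.coe_inj).1
    ((EuclideanSpace.basisFun (Fin d) ℝ).toBasis.ext fun i => ?_)
  ext k
  simpa using hx k i

lemma locallyIntegrable_lineDeriv_of_locallyLipschitz {f : EuclideanSpace ℝ (Fin d) → ℝ}
    (hf : LocallyLipschitz f) (v : EuclideanSpace ℝ (Fin d)) :
    LocallyIntegrable fun x => lineDeriv ℝ f x v := by
  intro x
  obtain ⟨K, t, ht, hK⟩ := hf x
  obtain ⟨r, hr, hrt⟩ := Metric.mem_nhds_iff.1 ht
  refine ⟨Metric.ball x r, Metric.ball_mem_nhds x hr, ?_⟩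
  refine Measure.integrableOn_of_bounded (M := K * ‖v‖) measure_ball_lt_top.ne
    (aestronglyMeasurable_lineDeriv hf.continuous _) ?_
  refine (ae_restrict_iff' measurableSet_ball).2 (Eventually.of_forall fun z hz => ?_)
  exact norm_lineDeriv_le_of_lipschitzOn ℝ (Metric.isOpen_ball.mem_nhds hz) (hK.mono hrt)

/-- Only the values of `f` near the support of `φ` matter, so `f` may be replaced by a Lipschitz
extension `F` of its restriction to a ball containing that support. Local Lipschitz continuity is
the right generality because the integrand of the risk is quadratic in a Lipschitz map. -/
lemma integral_lineDeriv_mul_of_locallyLipschitz {f φ : EuclideanSpace ℝ (Fin d) → ℝ}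
    (hf : LocallyLipschitz f) (hφ : ContDiff ℝ 1 φ) (hc : HasCompactSupport φ)
    (v : EuclideanSpace ℝ (Fin d)) :
    ∫ x, lineDeriv ℝ f x v * φ x = -∫ x, f x * fderiv ℝ φ x v := by
  obtain ⟨R, hR⟩ := hc.isCompact.isBounded.subset_ball 0
  obtain ⟨K, hK⟩ := LocallyLipschitzOn.exists_lipschitzOnWith_of_compact
    (isCompact_closedBall (0 : EuclideanSpace ℝ (Fin d)) R) hf.locallyLipschitzOn
  obtain ⟨F, hF, hFf⟩ := (hK.mono Metric.ball_subset_closedBall).extend_real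
  obtain ⟨C, hC⟩ := hφ.lipschitzWith_of_hasCompactSupport hc one_ne_zero
  have key := LipschitzWith.integral_lineDeriv_mul_eq (μ := volume) hF hC hc v
  have e1 : ∀ x, lineDeriv ℝ F x v * φ x = lineDeriv ℝ f x v * φ x := fun x => by
    by_cases hx : x ∈ tsupport φ
    · rw [Filter.EventuallyEq.lineDeriv_eq]
      filter_upwards [Metric.isOpen_ball.mem_nhds (hR hx)] with z hz using (hFf hz).symm
    · rw [image_eq_zero_of_notMem_tsupport hx, mul_zero, mul_zero]
  have e2 : ∀ x, lineDeriv ℝ φ x (-v) * F x = -(f x * fderiv ℝ φ x v) := fun x => by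
    rw [((hφ.differentiable one_ne_zero) x).lineDeriv_eq_fderiv, map_neg]
    by_cases hx : x ∈ tsupport φ
    · rw [← hFf (hR hx)]
      ring
    · rw [fderiv_of_notMem_tsupport ℝ hx]
      simp
  simp_rw [e1, e2] at key
  rw [key, integral_neg]

/-- The pointwise partial derivatives of a locally Lipschitz function are weak derivatives. -/
lemma isWeakPartialDeriv_of_locallyLipschitz {i : Fin d}
    {f g : EuclideanSpace ℝ (Fin d) → ℝ} (hf : LocallyLipschitz f)
    (hg : ∀ᵐ x, HasLineDerivAt ℝ f (g x) x (EuclideanSpace.single i 1)) :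
    IsWeakPartialDeriv U i f g := by
  have h : IsWeakPartialDeriv U i f fun x => lineDeriv ℝ f x (EuclideanSpace.single i 1) := by
    refine ⟨hf.continuous.locallyIntegrable.locallyIntegrableOn U,
      (locallyIntegrable_lineDeriv_of_locallyLipschitz hf _).locallyIntegrableOn U,
      fun φ hφ hc hs => ?_⟩
    rw [setIntegral_eq_integral_of_forall_compl_eq_zero,
      setIntegral_eq_integral_of_forall_compl_eq_zero,
      integral_lineDeriv_mul_of_locallyLipschitz hf hφ hc]
    · intro x hx
      rw [fderiv_of_notMem_tsupport ℝ fun hx' => hx (hs hx')]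
      simp
    · intro x hx
      rw [image_eq_zero_of_notMem_tsupport fun hx' => hx (hs hx'), mul_zero]
  exact h.congr (ae_eq_refl _) (ae_restrict_of_ae (hg.mono fun x hx => hx.lineDeriv))

/-- The pointwise gradient of a locally Lipschitz function is a weak gradient. -/
lemma isWeakGradient_of_locallyLipschitz
    {f : EuclideanSpace ℝ (Fin d) → ℝ} {g : EuclideanSpace ℝ (Fin d) → EuclideanSpace ℝ (Fin d)}
    (hf : LocallyLipschitz f) (hg : ∀ᵐ x, HasFDerivAt f (innerSL ℝ (g x)) x) :
    IsWeakGradient U f g := fun i =>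
  isWeakPartialDeriv_of_locallyLipschitz hf (hg.mono fun x hx => by
    simpa [EuclideanSpace.inner_single_right] using
      hx.hasLineDerivAt (EuclideanSpace.single i 1))

lemma locallyIntegrableOn_integral {Y : Type*} [MeasurableSpace Y] {ν : Measure Y} [SFinite ν]
    (hU : IsOpen U) {u : Y → EuclideanSpace ℝ (Fin d) → ℝ} {b : Y → ℝ}
    (hm : AEStronglyMeasurable (Function.uncurry u) (ν.prod (volume.restrict U)))
    (hb : Integrable b ν) (hub : ∀ y, ∀ x ∈ U, ‖u y x‖ ≤ b y) :
    LocallyIntegrableOn (fun x => ∫ y, u y x ∂ν) U := by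
  refine locallyIntegrableOn_of_locallyIntegrable_restrict ?_
  have h1 : AEStronglyMeasurable (fun x => ∫ y, u y x ∂ν) (volume.restrict U) :=
    hm.prod_swap.integral_prod_right'
  have h2 : ∀ᵐ x ∂(volume.restrict U), ‖∫ y, u y x ∂ν‖ ≤ ∫ y, b y ∂ν :=
    (ae_restrict_mem hU.measurableSet).mono fun x hx =>
      norm_integral_le_of_norm_le hb (Eventually.of_forall fun y => hub y x hx)
  exact (memLp_top_of_bound h1 _ h2).locallyIntegrable le_top

lemma setIntegral_integral_mul {Y : Type*} [MeasurableSpace Y] {ν : Measure Y} [SFinite ν]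
    (hU : IsOpen U) {u : Y → EuclideanSpace ℝ (Fin d) → ℝ} {b : Y → ℝ}
    (hm : AEStronglyMeasurable (Function.uncurry u) (ν.prod (volume.restrict U)))
    (hb : Integrable b ν) (hub : ∀ y, ∀ x ∈ U, ‖u y x‖ ≤ b y)
    {φ : EuclideanSpace ℝ (Fin d) → ℝ} (hφ : Integrable φ) :
    ∫ x in U, (∫ y, u y x ∂ν) * φ x = ∫ y, (∫ x in U, u y x * φ x) ∂ν := by
  simp_rw [← integral_mul_const]
  refine (integral_integral_swap ?_).symm
  have hbφ : Integrable (fun p : Y × EuclideanSpace ℝ (Fin d) => b p.1 * φ p.2)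
      (ν.prod (volume.restrict U)) := hb.mul_prod hφ.integrableOn
  refine hbφ.mono (hm.mul hφ.integrableOn.aestronglyMeasurable.comp_snd) ?_
  filter_upwards [Measure.quasiMeasurePreserving_snd.ae (ae_restrict_mem hU.measurableSet)]
    with p hp
  simp only [Function.uncurry, norm_mul]
  gcongr
  exact (hub _ _ hp).trans (le_abs_self _)

/-- Differentiation of an integral depending on a parameter, for weak gradients. -/
lemma isWeakGradient_integral {Y : Type*} [MeasurableSpace Y] {ν : Measure Y} [SFinite ν]
    (hU : IsOpen U) {f : Y → EuclideanSpace ℝ (Fin d) → ℝ}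
    {g : Y → EuclideanSpace ℝ (Fin d) → EuclideanSpace ℝ (Fin d)} {b : Y → ℝ}
    (hfm : AEStronglyMeasurable (Function.uncurry f) (ν.prod (volume.restrict U)))
    (hgm : AEStronglyMeasurable (Function.uncurry g) (ν.prod (volume.restrict U)))
    (hb : Integrable b ν) (hfb : ∀ y, ∀ x ∈ U, ‖f y x‖ ≤ b y)
    (hgb : ∀ y, ∀ x ∈ U, ‖g y x‖ ≤ b y)
    (h : ∀ᵐ y ∂ν, IsWeakGradient U (f y) (g y)) :
    IsWeakGradient U (fun x => ∫ y, f y x ∂ν) (fun x => ∫ y, g y x ∂ν) := by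
  intro i
  have him : AEStronglyMeasurable (Function.uncurry fun y x => g y x i)
      (ν.prod (volume.restrict U)) :=
    (EuclideanSpace.proj (𝕜 := ℝ) i).continuous.comp_aestronglyMeasurable hgm
  have hib : ∀ y, ∀ x ∈ U, ‖g y x i‖ ≤ b y := fun y x hx =>
    (PiLp.norm_apply_le (g y x) i).trans (hgb y x hx)
  have hi : (fun x => ∫ y, g y x i ∂ν) =ᵐ[volume.restrict U] fun x => (∫ y, g y x ∂ν) i := by
    -- Joint measurability makes the slice in y measurable for almost every x only, so the integral
    -- commutes with the coordinate almost everywhere, which is enough for a weak derivative.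
    filter_upwards [hgm.prod_swap.prodMk_left, ae_restrict_mem hU.measurableSet] with x hx hxU
    have hint : Integrable (fun y => g y x) ν :=
      hb.mono' hx (Eventually.of_forall fun y => hgb y x hxU)
    exact (EuclideanSpace.proj (𝕜 := ℝ) i).integral_comp_comm hint
  refine IsWeakPartialDeriv.congr ⟨locallyIntegrableOn_integral hU hfm hb hfb,
    locallyIntegrableOn_integral hU him hb hib, fun φ hφ hc hs => ?_⟩ (ae_eq_refl _) hi
  have hφ' : Continuous fun x => fderiv ℝ φ x (EuclideanSpace.single i 1) :=
    (hφ.continuous_fderiv one_ne_zero).clm_apply continuous_const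
  rw [setIntegral_integral_mul hU him hb hib (hφ.continuous.integrable_of_hasCompactSupport hc),
    setIntegral_integral_mul hU hfm hb hfb
      (hφ'.integrable_of_hasCompactSupport (hc.fderiv_apply ℝ _)), ← integral_neg]
  exact integral_congr_ae (h.mono fun y hy => (hy i).2.2 φ hφ hc hs)

end WeakDerivative

/-! ### Means over small balls and values at Lebesgue points -/

section LebesguePoint

variable {d : ℕ}

/-- The uniform probability measure on the ball of centre `θ` and radius `r`. -/
noncomputable abbrev ballMeasure (θ : EuclideanSpace ℝ (Fin d)) (r : ℝ) :
    Measure (EuclideanSpace ℝ (Fin d)) :=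
  cond volume (Metric.closedBall θ r)

variable {F : Type*} [NormedAddCommGroup F]

lemma setAverage_eq_integral_ballMeasure [NormedSpace ℝ F] (g : EuclideanSpace ℝ (Fin d) → F)
    (θ : EuclideanSpace ℝ (Fin d)) (r : ℝ) :
    ⨍ x in Metric.closedBall θ r, g x = ∫ x, g x ∂(ballMeasure θ r) := by
  rw [average, Measure.restrict_apply_univ]
  rfl

lemma isLebesguePoint_iff {g : EuclideanSpace ℝ (Fin d) → F} {θ : EuclideanSpace ℝ (Fin d)} :
    IsLebesguePoint g θ ↔
      Tendsto (fun r : ℝ => ∫ x, ‖g x - g θ‖ ∂(ballMeasure θ r)) (𝓝[>] 0) (𝓝 0) := by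
  simp only [IsLebesguePoint, setAverage_eq_integral_ballMeasure]

lemma isProbabilityMeasure_ballMeasure (θ : EuclideanSpace ℝ (Fin d)) {r : ℝ} (hr : 0 < r) :
    IsProbabilityMeasure (ballMeasure θ r) :=
  cond_isProbabilityMeasure_of_finite (Metric.measure_closedBall_pos volume θ hr).ne'
    measure_closedBall_lt_top.ne

lemma ballMeasure_absolutelyContinuous {U : Set (EuclideanSpace ℝ (Fin d))}
    {θ : EuclideanSpace ℝ (Fin d)} {r : ℝ} (h : Metric.closedBall θ r ⊆ U) :
    ballMeasure θ r ≪ volume.restrict U :=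
  (Measure.smul_absolutelyContinuous).trans (Measure.restrict_mono h le_rfl).absolutelyContinuous

lemma ae_ballMeasure_mem (θ : EuclideanSpace ℝ (Fin d)) (r : ℝ) :
    ∀ᵐ x ∂(ballMeasure θ r), x ∈ Metric.closedBall θ r :=
  ae_cond_mem measurableSet_closedBall

lemma eventually_closedBall_subset {U : Set (EuclideanSpace ℝ (Fin d))} (hU : IsOpen U)
    {θ : EuclideanSpace ℝ (Fin d)} (hθ : θ ∈ U) :
    ∀ᶠ r : ℝ in 𝓝[>] 0, 0 < r ∧ Metric.closedBall θ r ⊆ U :=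
  (eventually_mem_nhdsWithin).and
    (nhdsWithin_le_nhds (_root_.eventually_closedBall_subset (hU.mem_nhds hθ)))

variable [NormedSpace ℝ F] [CompleteSpace F]

lemma tendsto_integral_ballMeasure {u : EuclideanSpace ℝ (Fin d) → F}
    {θ : EuclideanSpace ℝ (Fin d)} {c : F}
    (hu : ∀ᶠ r in 𝓝[>] 0, Integrable u (ballMeasure θ r))
    (h : Tendsto (fun r : ℝ => ∫ x, ‖u x - c‖ ∂(ballMeasure θ r)) (𝓝[>] 0) (𝓝 0)) :
    Tendsto (fun r : ℝ => ∫ x, u x ∂(ballMeasure θ r)) (𝓝[>] 0) (𝓝 c) := by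
  rw [tendsto_iff_norm_sub_tendsto_zero]
  refine squeeze_zero' (Eventually.of_forall fun r => norm_nonneg _) ?_ h
  filter_upwards [hu, self_mem_nhdsWithin] with r hr hr0
  have := isProbabilityMeasure_ballMeasure θ (Set.mem_Ioi.1 hr0)
  calc ‖∫ x, u x ∂(ballMeasure θ r) - c‖ = ‖∫ x, (u x - c) ∂(ballMeasure θ r)‖ := by
        rw [integral_sub hr (integrable_const c)]
        simp
    _ ≤ _ := norm_integral_le_integral_norm _

/-- If a weak gradient is the integral of a family `g y`, its value at a Lebesgue point is the
integral of the limits of the means of the functions `g y`. -/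
lemma eq_integral_of_isLebesguePoint {Y : Type*} [MeasurableSpace Y] {ν : Measure Y} [SFinite ν]
    {U : Set (EuclideanSpace ℝ (Fin d))} (hU : IsOpen U)
    {g : Y → EuclideanSpace ℝ (Fin d) → F} {b : Y → ℝ}
    (hgm : AEStronglyMeasurable (Function.uncurry g) (ν.prod (volume.restrict U)))
    (hb : Integrable b ν) (hgb : ∀ y, ∀ x ∈ U, ‖g y x‖ ≤ b y)
    {G : EuclideanSpace ℝ (Fin d) → F} (hG : G =ᵐ[volume.restrict U] fun x => ∫ y, g y x ∂ν)
    {θ : EuclideanSpace ℝ (Fin d)} (hθ : θ ∈ U) (hGθ : IsLebesguePoint G θ) {g₀ : Y → F}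
    (hg₀ : ∀ᵐ y ∂ν, Tendsto (fun r : ℝ => ∫ x, g y x ∂(ballMeasure θ r)) (𝓝[>] 0)
      (𝓝 (g₀ y))) :
    G θ = ∫ y, g₀ y ∂ν := by
  have hball := eventually_closedBall_subset hU hθ
  have hprod : ∀ r : ℝ, 0 < r → Metric.closedBall θ r ⊆ U →
      Integrable (Function.uncurry g) (ν.prod (ballMeasure θ r)) := fun r hr hrU => by
    have := isProbabilityMeasure_ballMeasure θ hr
    refine (hb.comp_fst (ballMeasure θ r)).mono' (hgm.mono_ac
      (Measure.AbsolutelyContinuous.rfl.prod (ballMeasure_absolutelyContinuous hrU))) ?_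
    filter_upwards [Measure.quasiMeasurePreserving_snd.ae (ae_ballMeasure_mem θ r)] with p hp
    exact hgb _ _ (hrU hp)
  have hGint : ∀ᶠ r in 𝓝[>] 0, Integrable G (ballMeasure θ r) := by
    filter_upwards [hball] with r hr
    have := isProbabilityMeasure_ballMeasure θ hr.1
    exact (hprod r hr.1 hr.2).integral_prod_right.congr
      ((ballMeasure_absolutelyContinuous hr.2).ae_eq hG).symm
  have h1 := tendsto_integral_ballMeasure hGint (isLebesguePoint_iff.1 hGθ)
  -- The means over every ball inside `U` inherit the bound `b y`, which does not depend on the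
  -- radius.
  have h2 : Tendsto (fun r : ℝ => ∫ y, ∫ x, g y x ∂(ballMeasure θ r) ∂ν) (𝓝[>] 0)
      (𝓝 (∫ y, g₀ y ∂ν)) := by
    refine tendsto_integral_filter_of_dominated_convergence b ?_ ?_ hb hg₀
    · filter_upwards [hball] with r hr
      have := isProbabilityMeasure_ballMeasure θ hr.1
      exact (hprod r hr.1 hr.2).aestronglyMeasurable.integral_prod_right'
    · filter_upwards [hball] with r hr
      have := isProbabilityMeasure_ballMeasure θ hr.1
      refine Eventually.of_forall fun y => ?_
      calc ‖∫ x, g y x ∂(ballMeasure θ r)‖ ≤ ∫ _, b y ∂(ballMeasure θ r) :=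
            norm_integral_le_of_norm_le (integrable_const _)
              ((ae_ballMeasure_mem θ r).mono fun x hx => hgb y x (hr.2 hx))
        _ = b y := by simp
  -- By Fubini the mean of `G` is the integral over y of the means of `g y`; the two sides are the
  -- limits of these two expressions.
  refine tendsto_nhds_unique h1 (h2.congr' ?_)
  filter_upwards [hball] with r hr
  have := isProbabilityMeasure_ballMeasure θ hr.1
  rw [integral_integral_swap (hprod r hr.1 hr.2)]
  exact integral_congr_ae ((ballMeasure_absolutelyContinuous hr.2).ae_eq hG).symm

variable {P : ℕ}

lemma aestronglyMeasurable_adjoint_apply {α : Type*} [MeasurableSpace α] {m : Measure α}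
    {J : α → (EuclideanSpace ℝ (Fin d) →L[ℝ] EuclideanSpace ℝ (Fin P))}
    {v : α → EuclideanSpace ℝ (Fin P)} (hJ : AEStronglyMeasurable J m)
    (hv : AEStronglyMeasurable v m) :
    AEStronglyMeasurable (fun x => ContinuousLinearMap.adjoint (J x) (v x)) m := by
  have hA : AEStronglyMeasurable (fun x => ContinuousLinearMap.adjoint (J x)) m :=
    ContinuousLinearMap.adjoint.continuous.comp_aestronglyMeasurable hJ
  exact isBoundedBilinearMap_apply.continuous.comp_aestronglyMeasurable₂ hA hv

lemma norm_adjoint_apply_le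
    (J : EuclideanSpace ℝ (Fin d) →L[ℝ] EuclideanSpace ℝ (Fin P)) (v : EuclideanSpace ℝ (Fin P)) :
    ‖ContinuousLinearMap.adjoint J v‖ ≤ ‖J‖ * ‖v‖ := by
  simpa using (ContinuousLinearMap.adjoint J).le_opNorm v

lemma norm_adjoint_apply_sub_le
    (J j : EuclideanSpace ℝ (Fin d) →L[ℝ] EuclideanSpace ℝ (Fin P))
    (v w : EuclideanSpace ℝ (Fin P)) :
    ‖ContinuousLinearMap.adjoint J v - ContinuousLinearMap.adjoint j w‖
      ≤ ‖J - j‖ * ‖w‖ + ‖J‖ * ‖v - w‖ := by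
  have e : ContinuousLinearMap.adjoint J v - ContinuousLinearMap.adjoint j w
      = ContinuousLinearMap.adjoint (J - j) w + ContinuousLinearMap.adjoint J (v - w) := by
    rw [map_sub, map_sub, sub_apply]
    abel
  rw [e]
  exact (norm_add_le _ _).trans
    (add_le_add (norm_adjoint_apply_le _ _) (norm_adjoint_apply_le _ _))

/-- Write J* q - j* q(θ) = (J - j)* q(θ) + J* (q - q(θ)). The first term vanishes in mean by
hypothesis, the second is at most C K r on the ball. The limit `j` need not be `J θ`: later `J` is
`fderiv` and `j` the value of another representative. -/
lemma tendsto_integral_adjoint_apply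
    {J : EuclideanSpace ℝ (Fin d) → (EuclideanSpace ℝ (Fin d) →L[ℝ] EuclideanSpace ℝ (Fin P))}
    (hJm : AEStronglyMeasurable J) {C : ℝ} (hJ : ∀ x, ‖J x‖ ≤ C)
    {q : EuclideanSpace ℝ (Fin d) → EuclideanSpace ℝ (Fin P)} {K : ℝ≥0} (hq : LipschitzWith K q)
    {θ : EuclideanSpace ℝ (Fin d)} {j : EuclideanSpace ℝ (Fin d) →L[ℝ] EuclideanSpace ℝ (Fin P)}
    (h : Tendsto (fun r : ℝ => ∫ x, ‖J x - j‖ ∂(ballMeasure θ r)) (𝓝[>] 0) (𝓝 0)) :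
    Tendsto (fun r : ℝ => ∫ x, ContinuousLinearMap.adjoint (J x) (q x) ∂(ballMeasure θ r))
      (𝓝[>] 0) (𝓝 (ContinuousLinearMap.adjoint j (q θ))) := by
  have hC : 0 ≤ C := (norm_nonneg _).trans (hJ θ)
  have hac : ∀ r : ℝ, ballMeasure θ r ≪ volume := fun r => cond_absolutelyContinuous
  have hest : ∀ r : ℝ, ∀ x ∈ Metric.closedBall θ r, ‖ContinuousLinearMap.adjoint (J x) (q x)
      - ContinuousLinearMap.adjoint j (q θ)‖ ≤ ‖J x - j‖ * ‖q θ‖ + C * (K * r) := by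
    intro r x hx
    have hqx : ‖q x - q θ‖ ≤ K * r := (hq.norm_sub_le x θ).trans (by
      have : ‖x - θ‖ ≤ r := by simpa [dist_eq_norm] using hx
      gcongr)
    have h1 : ‖J x‖ * ‖q x - q θ‖ ≤ C * (K * r) :=
      mul_le_mul (hJ x) hqx (norm_nonneg _) hC
    have h2 := norm_adjoint_apply_sub_le (J x) j (q x) (q θ)
    linarith
  have hJint : ∀ r : ℝ, 0 < r → Integrable J (ballMeasure θ r) := fun r hr => by
    have := isProbabilityMeasure_ballMeasure θ hr
    exact Integrable.of_bound (hJm.mono_ac (hac r)) C (Eventually.of_forall hJ)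
  have hm : AEStronglyMeasurable fun x => ContinuousLinearMap.adjoint (J x) (q x) :=
    aestronglyMeasurable_adjoint_apply hJm hq.continuous.aestronglyMeasurable
  have hbint : ∀ r : ℝ, 0 < r →
      Integrable (fun x => ‖J x - j‖ * ‖q θ‖ + C * (K * r)) (ballMeasure θ r) := fun r hr => by
    have := isProbabilityMeasure_ballMeasure θ hr
    exact (((hJint r hr).sub (integrable_const j)).norm.mul_const _).add (integrable_const _)
  have hdint : ∀ r : ℝ, 0 < r → Integrable (fun x => ContinuousLinearMap.adjoint (J x) (q x)
      - ContinuousLinearMap.adjoint j (q θ)) (ballMeasure θ r) := fun r hr =>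
    (hbint r hr).mono' ((hm.mono_ac (hac r)).sub aestronglyMeasurable_const)
      ((ae_ballMeasure_mem θ r).mono (hest r))
  have hint : ∀ᶠ r in 𝓝[>] 0,
      Integrable (fun x => ContinuousLinearMap.adjoint (J x) (q x)) (ballMeasure θ r) := by
    filter_upwards [self_mem_nhdsWithin] with r hr
    have := isProbabilityMeasure_ballMeasure θ (Set.mem_Ioi.1 hr)
    refine ((hdint r hr).add (integrable_const (ContinuousLinearMap.adjoint j (q θ)))).congr
      (Eventually.of_forall fun x => ?_)
    simp only [Pi.add_apply, sub_add_cancel]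
  have hlim' : Tendsto (fun r : ℝ => ∫ x, ‖ContinuousLinearMap.adjoint (J x) (q x)
      - ContinuousLinearMap.adjoint j (q θ)‖ ∂(ballMeasure θ r)) (𝓝[>] 0) (𝓝 0) := by
    have hlim : Tendsto (fun r : ℝ => (∫ x, ‖J x - j‖ ∂(ballMeasure θ r)) * ‖q θ‖ + C * (K * r))
        (𝓝[>] 0) (𝓝 0) := by
      have hr : Tendsto (fun r : ℝ => C * (K * r)) (𝓝[>] 0) (𝓝 0) :=
        (Continuous.tendsto' (by fun_prop) 0 0 (by simp)).mono_left nhdsWithin_le_nhds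
      simpa using (h.mul_const ‖q θ‖).add hr
    have hnn : ∀ r : ℝ, 0 ≤ ∫ x, ‖ContinuousLinearMap.adjoint (J x) (q x)
        - ContinuousLinearMap.adjoint j (q θ)‖ ∂(ballMeasure θ r) := fun r =>
      integral_nonneg fun x => norm_nonneg _
    have hle : ∀ r : ℝ, 0 < r → ∫ x, ‖ContinuousLinearMap.adjoint (J x) (q x)
        - ContinuousLinearMap.adjoint j (q θ)‖ ∂(ballMeasure θ r)
        ≤ (∫ x, ‖J x - j‖ ∂(ballMeasure θ r)) * ‖q θ‖ + C * (K * r) := fun r hr => by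
      have := isProbabilityMeasure_ballMeasure θ hr
      have h1 := integral_mono_ae (hdint r hr).norm (hbint r hr)
        ((ae_ballMeasure_mem θ r).mono (hest r))
      have h2 : ∫ x, (‖J x - j‖ * ‖q θ‖ + C * (K * r)) ∂(ballMeasure θ r)
          = (∫ x, ‖J x - j‖ ∂(ballMeasure θ r)) * ‖q θ‖ + C * (K * r) := by
        have hd : Integrable (fun x => ‖J x - j‖ * ‖q θ‖) (ballMeasure θ r) :=
          ((hJint r hr).sub (integrable_const j)).norm.mul_const _
        rw [integral_add hd (integrable_const _), integral_mul_const]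
        simp
      exact h1.trans_eq h2
    exact squeeze_zero' (Eventually.of_forall hnn)
      (eventually_mem_nhdsWithin.mono fun r hr => hle r hr) hlim
  exact tendsto_integral_ballMeasure hint hlim'

end LebesguePoint

/-! ### The law of Y and the limits of the expectations as ε → 0 -/

section Observation

variable {P M d : ℕ}

/-- The law of the observation `Y = μ₀ + W`. -/
noncomputable def obsLaw (σ : ℝ) (μ₀ : EuclideanSpace ℝ (Fin P)) :
    Measure (EuclideanSpace ℝ (Fin P)) :=
  (multivariateGaussian 0 (σ ^ 2 • (1 : Matrix (Fin P) (Fin P) ℝ))).map fun w => μ₀ + w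

instance isGaussian_obsLaw (σ : ℝ) (μ₀ : EuclideanSpace ℝ (Fin P)) :
    IsGaussian (obsLaw σ μ₀) := by
  unfold obsLaw
  infer_instance

lemma hasLaw_obsLaw {Ω : Type*} [MeasurableSpace Ω] {Pr : Measure Ω} {σ : ℝ}
    {W : Ω → EuclideanSpace ℝ (Fin P)}
    (hW : HasLaw W (multivariateGaussian 0 (σ ^ 2 • (1 : Matrix (Fin P) (Fin P) ℝ))) Pr)
    (μ₀ : EuclideanSpace ℝ (Fin P)) : HasLaw (fun ω => μ₀ + W ω) (obsLaw σ μ₀) Pr :=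
  HasLaw.fun_comp ⟨(measurable_const_add μ₀).aemeasurable, rfl⟩ hW

/-- Transfers statements valid for Lebesgue-almost every y to the law of the observation. -/
lemma obsLaw_absolutelyContinuous {σ : ℝ} (hσ : 0 < σ) (μ₀ : EuclideanSpace ℝ (Fin P)) :
    obsLaw σ μ₀ ≪ volume := by
  have h : obsLaw σ μ₀ ≪ (volume : Measure (EuclideanSpace ℝ (Fin P))).map fun w => μ₀ + w := by
    refine Measure.AbsolutelyContinuous.map ?_ (measurable_const_add μ₀)
    rw [multivariateGaussian_eq_withDensity hσ]
    exact withDensity_absolutelyContinuous _ _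
  rwa [map_add_left_eq_self] at h

lemma memLp_id_obsLaw (σ : ℝ) (μ₀ : EuclideanSpace ℝ (Fin P)) :
    MemLp (fun y => y) 2 (obsLaw σ μ₀) := IsGaussian.memLp_two_id

lemma integral_id_obsLaw (σ : ℝ) (μ₀ : EuclideanSpace ℝ (Fin P)) :
    ∫ y, y ∂(obsLaw σ μ₀) = μ₀ := by
  rw [obsLaw, integral_map (by fun_prop) (by fun_prop), integral_add (integrable_const _)
    IsGaussian.integrable_fun_id]
  simp

/-- Stein's identity for the centred noise, recentred at `μ₀`. The limit exists although `h` may be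
nowhere differentiable, since convolution with the Gaussian density smooths it. -/
lemma tendsto_integral_obsLaw_translate {F : Type*} [NormedAddCommGroup F] [NormedSpace ℝ F]
    {σ : ℝ} (hσ : 0 < σ) (μ₀ : EuclideanSpace ℝ (Fin P))
    {h : EuclideanSpace ℝ (Fin P) → F} (hm : AEStronglyMeasurable h) {C : ℝ}
    (hC : ∀ᵐ y, ‖h y‖ ≤ C) (e : EuclideanSpace ℝ (Fin P)) :
    Tendsto (fun ε : ℝ => (1 / ε) •
        (∫ y, h (y + ε • e) ∂(obsLaw σ μ₀) - ∫ y, h y ∂(obsLaw σ μ₀))) (𝓝[>] 0)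
      (𝓝 (∫ y, ((σ ^ 2)⁻¹ * inner ℝ (y - μ₀) e) • h y ∂(obsLaw σ μ₀))) := by
  have hmp := measurePreserving_add_left (volume : Measure (EuclideanSpace ℝ (Fin P))) μ₀
  have hemb : MeasurableEmbedding fun w : EuclideanSpace ℝ (Fin P) => μ₀ + w :=
    measurableEmbedding_addLeft μ₀
  -- For this b the factor 2b in the derivative of the density is σ⁻².
  have hb : 0 < 1 / (2 * σ ^ 2) := by positivity
  have key := hasDerivAt_integral_gaussian_translate (h := fun w => h (μ₀ + w)) hb
    (hm.comp_measurePreserving hmp) (hmp.quasiMeasurePreserving.ae hC) e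
  rw [← multivariateGaussian_eq_withDensity hσ, hasDerivAt_iff_tendsto_slope_zero] at key
  have key' := key.mono_left (nhdsGT_le_nhdsNE 0)
  simp only [obsLaw, hemb.integral_map]
  refine (key'.congr fun ε => ?_).trans_eq ?_
  · simp only [zero_add, zero_smul, add_zero, one_div, add_assoc]
  · congr 2
    ext w
    rw [add_sub_cancel_left]
    congr 2
    field_simp

lemma ExpectationTendsTo.comp_hasLaw {Ω Y : Type*} [MeasurableSpace Ω] [MeasurableSpace Y]
    {Pr : Measure Ω} {ν : Measure Y} {X : Ω → Y} (hX : HasLaw X ν Pr)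
    {F : ℝ → Y → EuclideanSpace ℝ (Fin d)} {v : EuclideanSpace ℝ (Fin d)}
    (h : ExpectationTendsTo ν F v) : ExpectationTendsTo Pr (fun ε ω => F ε (X ω)) v := by
  refine ⟨fun ε hε => ?_, h.2.congr' ?_⟩
  · have := h.1 ε hε
    rw [← hX.map_eq] at this
    exact this.comp_aemeasurable hX.aemeasurable
  · filter_upwards [self_mem_nhdsWithin] with ε hε
    exact (hX.integral_comp (h.1 ε hε).aestronglyMeasurable).symm

variable (A : EuclideanSpace ℝ (Fin P) →L[ℝ] EuclideanSpace ℝ (Fin M))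
  {J : EuclideanSpace ℝ (Fin P) → EuclideanSpace ℝ (Fin d) →
    (EuclideanSpace ℝ (Fin d) →L[ℝ] EuclideanSpace ℝ (Fin P))}
  {θ : EuclideanSpace ℝ (Fin d)}

/-- Reassembles the Stein limits along the basis vectors: the weights ⟨x, eⱼ⟩, with x = y - μ₀,
expand x by linearity. -/
lemma sum_inner_smul_adjoint (x : EuclideanSpace ℝ (Fin P))
    (L : EuclideanSpace ℝ (Fin P) →L[ℝ] EuclideanSpace ℝ (Fin d)) (c : ℝ) :
    ∑ j, (c * inner ℝ x (EuclideanSpace.single j 1))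
        • L (ContinuousLinearMap.adjoint A (A (EuclideanSpace.single j 1)))
      = c • L (ContinuousLinearMap.adjoint A (A x)) := by
  have hx : x = ∑ j, inner ℝ x (EuclideanSpace.single j 1) • EuclideanSpace.single j (1 : ℝ) := by
    simpa [real_inner_comm] using ((EuclideanSpace.basisFun (Fin P) ℝ).sum_repr' x).symm
  conv_rhs => rw [hx]
  simp only [map_sum, map_smul, Finset.smul_sum, smul_smul]

lemma norm_adjoint_adjoint_le (L : EuclideanSpace ℝ (Fin d) →L[ℝ] EuclideanSpace ℝ (Fin P))
    (v : EuclideanSpace ℝ (Fin P)) :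
    ‖ContinuousLinearMap.adjoint L (ContinuousLinearMap.adjoint A (A v))‖
      ≤ ‖L‖ * (‖A‖ * ‖A‖ * ‖v‖) := by
  refine (norm_adjoint_apply_le _ _).trans ?_
  gcongr
  refine ((ContinuousLinearMap.adjoint A).le_opNorm _).trans ?_
  rw [LinearIsometryEquiv.norm_map, mul_assoc]
  gcongr
  exact A.le_opNorm v

lemma integrable_adjoint_adjoint {m : Measure (EuclideanSpace ℝ (Fin P))}
    {j : EuclideanSpace ℝ (Fin P) → (EuclideanSpace ℝ (Fin d) →L[ℝ] EuclideanSpace ℝ (Fin P))}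
    (hj : AEStronglyMeasurable j m) {C : ℝ} (hC : ∀ᵐ y ∂m, ‖j y‖ ≤ C)
    {q : EuclideanSpace ℝ (Fin P) → EuclideanSpace ℝ (Fin P)} (hq : Integrable q m) :
    Integrable (fun y => ContinuousLinearMap.adjoint (j y)
      (ContinuousLinearMap.adjoint A (A (q y)))) m := by
  refine (hq.norm.const_mul (C * (‖A‖ * ‖A‖))).mono' (aestronglyMeasurable_adjoint_apply hj
    ((ContinuousLinearMap.adjoint A).continuous.comp_aestronglyMeasurable
      (A.continuous.comp_aestronglyMeasurable hq.1))) ?_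
  filter_upwards [hC] with y hy
  refine (norm_adjoint_adjoint_le A _ _).trans ?_
  rw [mul_assoc C]
  gcongr

lemma gradDofFD_eq (y : EuclideanSpace ℝ (Fin P)) (θ : EuclideanSpace ℝ (Fin d)) (ε : ℝ) :
    gradDofFD A J y θ ε = ∑ j : Fin P, (1 / ε) •
      (ContinuousLinearMap.adjoint (J (y + ε • EuclideanSpace.single j 1) θ)
        (ContinuousLinearMap.adjoint A (A (EuclideanSpace.single j 1)))
      - ContinuousLinearMap.adjoint (J y θ)
        (ContinuousLinearMap.adjoint A (A (EuclideanSpace.single j 1)))) := by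
  rw [gradDofFD, Finset.smul_sum]
  refine Finset.sum_congr rfl fun j _ => ?_
  rw [map_sub, sub_apply]

/-- The almost-everywhere bound survives the shift because Lebesgue measure is translation invariant
and dominates the Gaussian law. -/
lemma integrable_obsLaw_translate {σ : ℝ} (hσ : 0 < σ) (μ₀ : EuclideanSpace ℝ (Fin P))
    (hJm : AEStronglyMeasurable fun y => J y θ) {C : ℝ} (hC : ∀ᵐ y, ‖J y θ‖ ≤ C)
    (e v : EuclideanSpace ℝ (Fin P)) :
    Integrable (fun y => ContinuousLinearMap.adjoint (J (y + e) θ)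
        (ContinuousLinearMap.adjoint A (A v))) (obsLaw σ μ₀) := by
  have hmp := measurePreserving_add_right (volume : Measure (EuclideanSpace ℝ (Fin P))) e
  have hac := obsLaw_absolutelyContinuous hσ μ₀
  exact integrable_adjoint_adjoint A ((hJm.comp_measurePreserving hmp).mono_ac hac)
    (hac.ae_le (hmp.quasiMeasurePreserving.ae hC)) (integrable_const v)

lemma expectationTendsTo_gradDofFD {σ : ℝ} (hσ : 0 < σ) (μ₀ : EuclideanSpace ℝ (Fin P))
    (hJm : AEStronglyMeasurable fun y => J y θ) {C : ℝ} (hC : ∀ᵐ y, ‖J y θ‖ ≤ C) :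
    ExpectationTendsTo (obsLaw σ μ₀) (fun ε y => gradDofFD A J y θ ε)
      (∫ y, (σ ^ 2)⁻¹ • ContinuousLinearMap.adjoint (J y θ)
        (ContinuousLinearMap.adjoint A (A (y - μ₀))) ∂(obsLaw σ μ₀)) := by
  have hac := obsLaw_absolutelyContinuous hσ μ₀
  have hi := integrable_obsLaw_translate A hσ μ₀ hJm hC
  have hi0 : ∀ v, Integrable (fun y => ContinuousLinearMap.adjoint (J y θ)
        (ContinuousLinearMap.adjoint A (A v))) (obsLaw σ μ₀) := fun v => by
    simpa using hi 0 v
  simp only [gradDofFD_eq]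
  have hs : ∀ (ε : ℝ) (j : Fin P), Integrable (fun y => (1 / ε) •
      (ContinuousLinearMap.adjoint (J (y + ε • EuclideanSpace.single j 1) θ)
        (ContinuousLinearMap.adjoint A (A (EuclideanSpace.single j 1)))
      - ContinuousLinearMap.adjoint (J y θ)
        (ContinuousLinearMap.adjoint A (A (EuclideanSpace.single j 1))))) (obsLaw σ μ₀) :=
    fun ε j => ((hi _ _).sub (hi0 _)).smul (1 / ε)
  refine ⟨fun ε hε => integrable_finsetSum _ fun j _ => hs ε j, ?_⟩
  have hlim := tendsto_finsetSum Finset.univ fun (j : Fin P) _ =>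
    tendsto_integral_obsLaw_translate hσ μ₀
      (h := fun y => ContinuousLinearMap.adjoint (J y θ)
        (ContinuousLinearMap.adjoint A (A (EuclideanSpace.single j 1))))
      (aestronglyMeasurable_adjoint_apply hJm aestronglyMeasurable_const)
      (C := C * (‖A‖ * ‖A‖ * ‖EuclideanSpace.single j (1 : ℝ)‖))
      (hC.mono fun y hy => (norm_adjoint_adjoint_le A _ _).trans (by gcongr))
      (EuclideanSpace.single j 1)
  have hq : Integrable (fun y => y - μ₀) (obsLaw σ μ₀) :=
    ((memLp_id_obsLaw σ μ₀).integrable one_le_two).sub (integrable_const _)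
  have hterm : ∀ j : Fin P, Integrable (fun y =>
      ((σ ^ 2)⁻¹ * inner ℝ (y - μ₀) (EuclideanSpace.single j 1)) •
        ContinuousLinearMap.adjoint (J y θ)
          (ContinuousLinearMap.adjoint A (A (EuclideanSpace.single j 1)))) (obsLaw σ μ₀) := by
    intro j
    have h1 : Integrable (fun y => ((σ ^ 2)⁻¹ * inner ℝ (y - μ₀) (EuclideanSpace.single j 1)))
        (obsLaw σ μ₀) := (hq.inner_const _).const_mul _
    exact h1.smul_bdd (C * (‖A‖ * ‖A‖ * ‖EuclideanSpace.single j (1 : ℝ)‖)) (hi0 _).1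
      (hac.ae_le (hC.mono fun y hy => (norm_adjoint_adjoint_le A _ _).trans (by gcongr)))
  rw [← integral_finsetSum _ fun j _ => hterm j] at hlim
  simp only [sum_inner_smul_adjoint] at hlim
  refine hlim.congr fun ε => ?_
  beta_reduce
  rw [integral_finsetSum _ fun j _ => hs ε j]
  refine Finset.sum_congr rfl fun j _ => ?_
  rw [integral_smul, integral_sub (hi _ _) (hi0 _)]

/-- The residual μ - y is observable, μ - μ₀ is not; the Stein limit supplies the missing y - μ₀. -/
lemma expectationTendsTo_sugar {σ : ℝ} (hσ : 0 < σ) (μ₀ : EuclideanSpace ℝ (Fin P))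
    {μ : EuclideanSpace ℝ (Fin P) → EuclideanSpace ℝ (Fin d) → EuclideanSpace ℝ (Fin P)}
    (hμ : Integrable (fun y => μ y θ) (obsLaw σ μ₀))
    (hJm : AEStronglyMeasurable fun y => J y θ) {C : ℝ} (hC : ∀ᵐ y, ‖J y θ‖ ≤ C) :
    ExpectationTendsTo (obsLaw σ μ₀) (fun ε y => sugar σ A μ J y θ ε)
      (∫ y, (2 : ℝ) • ContinuousLinearMap.adjoint (J y θ)
        (ContinuousLinearMap.adjoint A (A (μ y θ - μ₀))) ∂(obsLaw σ μ₀)) := by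
  have hac := obsLaw_absolutelyContinuous hσ μ₀
  obtain ⟨hi, hlim⟩ := expectationTendsTo_gradDofFD A hσ μ₀ hJm hC
  have hid := (memLp_id_obsLaw σ μ₀).integrable one_le_two
  have hint : ∀ {q : EuclideanSpace ℝ (Fin P) → EuclideanSpace ℝ (Fin P)},
      Integrable q (obsLaw σ μ₀) → Integrable (fun y => ContinuousLinearMap.adjoint (J y θ)
        (ContinuousLinearMap.adjoint A (A (q y)))) (obsLaw σ μ₀) := fun hq =>
    integrable_adjoint_adjoint A (hJm.mono_ac hac) (hac.ae_le hC) hq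
  have h1 : Integrable (fun y => (2 : ℝ) • ContinuousLinearMap.adjoint (J y θ)
      (ContinuousLinearMap.adjoint A (A (μ y θ - y)))) (obsLaw σ μ₀) :=
    (hint (hμ.sub hid)).smul (2 : ℝ)
  have h2 : Integrable (fun y => (2 * σ ^ 2) • (σ ^ 2)⁻¹ • ContinuousLinearMap.adjoint (J y θ)
      (ContinuousLinearMap.adjoint A (A (y - μ₀)))) (obsLaw σ μ₀) :=
    ((hint (hid.sub (integrable_const μ₀))).smul ((σ ^ 2)⁻¹)).smul (2 * σ ^ 2)
  refine ⟨fun ε hε => h1.add ((hi ε hε).smul (2 * σ ^ 2)), ?_⟩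
  have hsum : ∫ y, (2 : ℝ) • ContinuousLinearMap.adjoint (J y θ)
        (ContinuousLinearMap.adjoint A (A (μ y θ - μ₀))) ∂(obsLaw σ μ₀)
      = ∫ y, (2 : ℝ) • ContinuousLinearMap.adjoint (J y θ)
        (ContinuousLinearMap.adjoint A (A (μ y θ - y))) ∂(obsLaw σ μ₀)
      + (2 * σ ^ 2) • ∫ y, (σ ^ 2)⁻¹ • ContinuousLinearMap.adjoint (J y θ)
        (ContinuousLinearMap.adjoint A (A (y - μ₀))) ∂(obsLaw σ μ₀) := by
    rw [← integral_smul, ← integral_add h1 h2]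
    refine integral_congr_ae (Eventually.of_forall fun y => ?_)
    have e : 2 * σ ^ 2 * (σ ^ 2)⁻¹ = 2 := by field_simp
    simp only [smul_smul, e, ← smul_add, ← map_add, sub_add_sub_cancel]
  rw [hsum]
  refine ((hlim.const_smul (2 * σ ^ 2)).const_add _).congr' ?_
  filter_upwards [self_mem_nhdsWithin] with ε hε
  simp only [sugar]
  rw [← integral_smul]
  exact (integral_add h1 ((hi ε hε).smul (2 * σ ^ 2))).symm

end Observation

/-! ### Lipschitz extension, Rademacher derivative and weak gradients of the estimators -/

section Parameter

variable {P M d : ℕ}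

/-- Separate Lipschitz bounds add up to a joint one on ℝᴾ × Θ, and Lipschitz maps into a
finite-dimensional space extend at the cost of a larger constant. The extension makes Rademacher's
theorem and joint measurability of `fderiv` available on the whole space. -/
lemma exists_lipschitzWith_extension {Θ : Set (EuclideanSpace ℝ (Fin d))}
    {μ : EuclideanSpace ℝ (Fin P) → EuclideanSpace ℝ (Fin d) → EuclideanSpace ℝ (Fin P)}
    {L₁ L₂ : ℝ≥0} (h₁ : ∀ θ ∈ Θ, LipschitzWith L₁ (fun y => μ y θ))
    (h₂ : ∀ y, LipschitzOnWith L₂ (μ y) Θ) :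
    ∃ (K : ℝ≥0) (m : EuclideanSpace ℝ (Fin P) → EuclideanSpace ℝ (Fin d) →
      EuclideanSpace ℝ (Fin P)), LipschitzWith K (Function.uncurry m) ∧
        ∀ y, ∀ θ ∈ Θ, m y θ = μ y θ := by
  have h : LipschitzOnWith (L₁ + L₂) (Function.uncurry μ) (Set.univ ×ˢ Θ) := by
    refine LipschitzOnWith.of_dist_le_mul fun p hp q hq => ?_
    have e1 := (h₁ p.2 hp.2).dist_le_mul p.1 q.1
    have e2 := (h₂ q.1).dist_le_mul p.2 hp.2 q.2 hq.2
    have d1 : dist p.1 q.1 ≤ dist p q := le_max_left _ _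
    have d2 : dist p.2 q.2 ≤ dist p q := le_max_right _ _
    calc dist (μ p.1 p.2) (μ q.1 q.2)
        ≤ dist (μ p.1 p.2) (μ q.1 p.2) + dist (μ q.1 p.2) (μ q.1 q.2) := dist_triangle _ _ _
      _ ≤ L₁ * dist p q + L₂ * dist p q := by
        refine add_le_add (e1.trans ?_) (e2.trans ?_) <;> gcongr
      _ = _ := by
        push_cast
        ring
  obtain ⟨g, hg, hgμ⟩ := h.extend_finite_dimension
  exact ⟨_, fun y θ => g (y, θ), hg, fun y θ hθ => (hgμ ⟨Set.mem_univ y, hθ⟩).symm⟩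

section Lipschitz

variable {m : EuclideanSpace ℝ (Fin P) → EuclideanSpace ℝ (Fin d) → EuclideanSpace ℝ (Fin P)}
  {K : ℝ≥0}

lemma lipschitzWith_param (hm : LipschitzWith K (Function.uncurry m))
    (y : EuclideanSpace ℝ (Fin P)) : LipschitzWith K (m y) := by
  have h := hm.comp (LipschitzWith.prodMk_left y)
  rwa [mul_one] at h

lemma norm_fderiv_param_le (hm : LipschitzWith K (Function.uncurry m))
    (y : EuclideanSpace ℝ (Fin P)) (θ : EuclideanSpace ℝ (Fin d)) :
    ‖fderiv ℝ (m y) θ‖ ≤ K :=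
  norm_fderiv_le_of_lipschitz ℝ (lipschitzWith_param hm y)

lemma measurable_fderiv_param (hm : LipschitzWith K (Function.uncurry m)) :
    Measurable (Function.uncurry fun y θ => fderiv ℝ (m y) θ) :=
  measurable_fderiv_with_param ℝ hm.continuous

lemma ae_hasFDerivAt_param (hm : LipschitzWith K (Function.uncurry m))
    (y : EuclideanSpace ℝ (Fin P)) : ∀ᵐ θ, HasFDerivAt (m y) (fderiv ℝ (m y) θ) θ :=
  (lipschitzWith_param hm y).ae_differentiableAt.mono fun _ h => h.hasFDerivAt

variable {μ : EuclideanSpace ℝ (Fin P) → EuclideanSpace ℝ (Fin d) → EuclideanSpace ℝ (Fin P)}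
  {Θ : Set (EuclideanSpace ℝ (Fin d))}

lemma isWeakJacobian_fderiv (hΘ : MeasurableSet Θ) (hm : LipschitzWith K (Function.uncurry m))
    (hmμ : ∀ y, ∀ θ ∈ Θ, m y θ = μ y θ) (y : EuclideanSpace ℝ (Fin P)) :
    IsWeakJacobian Θ (μ y) (fun θ => fderiv ℝ (m y) θ) := by
  intro k i
  have hk : LocallyLipschitz fun θ => m y θ k :=
    ((EuclideanSpace.proj (𝕜 := ℝ) k).lipschitz.comp
      (lipschitzWith_param hm y)).locallyLipschitz
  refine IsWeakPartialDeriv.congr (isWeakPartialDeriv_of_locallyLipschitz hk ?_)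
    ((ae_restrict_mem hΘ).mono fun θ hθ => by simp only [hmμ y θ hθ]) (ae_eq_refl _)
  filter_upwards [ae_hasFDerivAt_param hm y] with θ hθ
  exact ((EuclideanSpace.proj (𝕜 := ℝ) k).hasFDerivAt.comp θ hθ).hasLineDerivAt _

lemma isWeakJacobianInParam_fderiv (hΘ : MeasurableSet Θ)
    (hm : LipschitzWith K (Function.uncurry m)) (hmμ : ∀ y, ∀ θ ∈ Θ, m y θ = μ y θ) :
    IsWeakJacobianInParam Θ μ (fun y θ => fderiv ℝ (m y) θ) :=
  ⟨(measurable_fderiv_param hm).aestronglyMeasurable,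
    Eventually.of_forall (isWeakJacobian_fderiv hΘ hm hmμ)⟩

variable {J : EuclideanSpace ℝ (Fin P) → EuclideanSpace ℝ (Fin d) →
  (EuclideanSpace ℝ (Fin d) →L[ℝ] EuclideanSpace ℝ (Fin P))}

lemma IsWeakJacobianInParam.ae_eq_fderiv (hΘ : IsOpen Θ) (hJ : IsWeakJacobianInParam Θ μ J)
    (hm : LipschitzWith K (Function.uncurry m)) (hmμ : ∀ y, ∀ θ ∈ Θ, m y θ = μ y θ) :
    ∀ᵐ y, J y =ᵐ[volume.restrict Θ] fun θ => fderiv ℝ (m y) θ :=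
  hJ.isWeakJacobian.mono fun y hy =>
    hy.ae_eq hΘ (isWeakJacobian_fderiv hΘ.measurableSet hm hmμ y)

/-- Exchanges "almost every y, then almost every θ" for the reverse order by Fubini. -/
lemma IsWeakJacobianInParam.ae_ae_eq_fderiv (hΘ : IsOpen Θ) (hJ : IsWeakJacobianInParam Θ μ J)
    (hm : LipschitzWith K (Function.uncurry m)) (hmμ : ∀ y, ∀ θ ∈ Θ, m y θ = μ y θ) :
    ∀ᵐ θ ∂(volume.restrict Θ), ∀ᵐ y, J y θ = fderiv ℝ (m y) θ := by
  -- Fubini for null sets needs a measurable coincidence set, hence the detour through a measurable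
  -- version of `J`.
  have hmk := hJ.aestronglyMeasurable.ae_eq_mk
  have hset : MeasurableSet {p : EuclideanSpace ℝ (Fin P) × EuclideanSpace ℝ (Fin d) |
      hJ.aestronglyMeasurable.mk _ p = Function.uncurry (fun y θ => fderiv ℝ (m y) θ) p} :=
    measurableSet_eq_fun hJ.aestronglyMeasurable.stronglyMeasurable_mk.measurable
      (measurable_fderiv_param hm)
  have h1 : ∀ᵐ p ∂((volume : Measure (EuclideanSpace ℝ (Fin P))).prod (volume.restrict Θ)),
      hJ.aestronglyMeasurable.mk _ p = Function.uncurry (fun y θ => fderiv ℝ (m y) θ) p := by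
    refine (Measure.ae_prod_iff_ae_ae hset).2 ?_
    filter_upwards [Measure.ae_ae_of_ae_prod hmk, hJ.ae_eq_fderiv hΘ hm hmμ] with y h2 h3
    filter_upwards [h2, h3] with θ h4 h5
    exact h4.symm.trans h5
  have h2 : ∀ᵐ p ∂((volume : Measure (EuclideanSpace ℝ (Fin P))).prod (volume.restrict Θ)),
      J p.1 p.2 = fderiv ℝ (m p.1) p.2 := by
    filter_upwards [hmk, h1] with p h3 h4
    exact h3.trans h4
  exact Measure.ae_ae_of_ae_prod (Measure.measurePreserving_swap.quasiMeasurePreserving.ae h2)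

variable (A : EuclideanSpace ℝ (Fin P) →L[ℝ] EuclideanSpace ℝ (Fin M))

lemma locallyLipschitz_norm_sq (hm : LipschitzWith K (Function.uncurry m))
    (y z : EuclideanSpace ℝ (Fin P)) : LocallyLipschitz fun θ => ‖A (m y θ - z)‖ ^ 2 := by
  have h : ContDiff ℝ 1 fun x => ‖A (x - z)‖ ^ 2 :=
    (A.contDiff.comp (contDiff_id.sub contDiff_const)).norm_sq ℝ
  exact h.locallyLipschitz.comp (lipschitzWith_param hm y).locallyLipschitz

lemma hasFDerivAt_norm_sq {y z : EuclideanSpace ℝ (Fin P)} {θ : EuclideanSpace ℝ (Fin d)}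
    {L : EuclideanSpace ℝ (Fin d) →L[ℝ] EuclideanSpace ℝ (Fin P)} (h : HasFDerivAt (m y) L θ) :
    HasFDerivAt (fun θ => ‖A (m y θ - z)‖ ^ 2) (innerSL ℝ ((2 : ℝ) •
      ContinuousLinearMap.adjoint L (ContinuousLinearMap.adjoint A (A (m y θ - z))))) θ := by
  refine (A.hasFDerivAt.comp θ (h.sub_const z)).norm_sq.congr_fderiv ?_
  ext v
  simp [ContinuousLinearMap.adjoint_inner_left]

lemma isWeakGradient_norm_sq (hm : LipschitzWith K (Function.uncurry m))
    (y z : EuclideanSpace ℝ (Fin P)) :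
    IsWeakGradient Θ (fun θ => ‖A (m y θ - z)‖ ^ 2) (fun θ => (2 : ℝ) •
      ContinuousLinearMap.adjoint (fderiv ℝ (m y) θ)
        (ContinuousLinearMap.adjoint A (A (m y θ - z)))) :=
  isWeakGradient_of_locallyLipschitz (locallyLipschitz_norm_sq A hm y z)
    ((ae_hasFDerivAt_param hm y).mono fun _ h => hasFDerivAt_norm_sq A h)

lemma isWeakGradient_inner (hm : LipschitzWith K (Function.uncurry m))
    (y z : EuclideanSpace ℝ (Fin P)) (c : ℝ) :
    IsWeakGradient Θ (fun θ => c * inner ℝ (A z) (A (m y θ))) (fun θ => c •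
      ContinuousLinearMap.adjoint (fderiv ℝ (m y) θ)
        (ContinuousLinearMap.adjoint A (A z))) := by
  have h : ContDiff ℝ 1 fun x => c * inner ℝ (A z) (A x) :=
    contDiff_const.mul (contDiff_const.inner ℝ A.contDiff)
  refine isWeakGradient_of_locallyLipschitz
    (h.locallyLipschitz.comp (lipschitzWith_param hm y).locallyLipschitz)
    ((ae_hasFDerivAt_param hm y).mono fun θ h => ?_)
  have h1 : HasFDerivAt (fun θ => inner ℝ (A z) (A (m y θ)))
      (innerSL ℝ (A z) ∘L (A ∘L fderiv ℝ (m y) θ)) θ :=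
    (innerSL ℝ (A z)).hasFDerivAt.comp θ (A.hasFDerivAt.comp θ h)
  refine (h1.const_mul c).congr_fderiv ?_
  ext v
  simp [ContinuousLinearMap.adjoint_inner_left]

/-- With A*A moved onto eⱼ, the estimator is a linear functional of values of `m`, and its
derivative reads off as `gradDofFD`. -/
lemma dofFD_eq (y : EuclideanSpace ℝ (Fin P)) (θ : EuclideanSpace ℝ (Fin d)) (ε : ℝ) :
    dofFD A m y θ ε = (1 / ε) * ∑ j : Fin P,
      inner ℝ (ContinuousLinearMap.adjoint A (A (EuclideanSpace.single j 1)))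
        (m (y + ε • EuclideanSpace.single j 1) θ - m y θ) := by
  rw [dofFD]
  congr 1
  refine Finset.sum_congr rfl fun j _ => ?_
  rw [ContinuousLinearMap.adjoint_inner_left, ← ContinuousLinearMap.adjoint_inner_right,
    EuclideanSpace.inner_single_left]
  simp

lemma locallyLipschitz_finsetSum {ι X F : Type*} [PseudoEMetricSpace X]
    [SeminormedAddCommGroup F] (s : Finset ι) {f : ι → X → F}
    (h : ∀ i ∈ s, LocallyLipschitz (f i)) : LocallyLipschitz fun x => ∑ i ∈ s, f i x := by
  classical
  induction s using Finset.induction_on with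
  | empty => simpa using LocallyLipschitz.const 0
  | insert i s hi ih =>
    simp only [Finset.sum_insert hi]
    exact (h i (Finset.mem_insert_self i s)).add
      (ih fun j hj => h j (Finset.mem_insert_of_mem hj))

lemma locallyLipschitz_const_mul {X : Type*} [PseudoEMetricSpace X] {f : X → ℝ}
    (h : LocallyLipschitz f) (c : ℝ) : LocallyLipschitz fun x => c * f x :=
  (lipschitzWith_smul c).locallyLipschitz.comp h

lemma locallyLipschitz_dofFD (hm : LipschitzWith K (Function.uncurry m))
    (y : EuclideanSpace ℝ (Fin P)) (ε : ℝ) : LocallyLipschitz fun θ => dofFD A m y θ ε := by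
  simp only [dofFD_eq]
  refine locallyLipschitz_const_mul (locallyLipschitz_finsetSum _ fun j _ => ?_) _
  exact ((innerSL ℝ _).lipschitz.locallyLipschitz).comp
    ((lipschitzWith_param hm _).locallyLipschitz.sub (lipschitzWith_param hm _).locallyLipschitz)

lemma ae_hasFDerivAt_dofFD (hm : LipschitzWith K (Function.uncurry m))
    (y : EuclideanSpace ℝ (Fin P)) (ε : ℝ) :
    ∀ᵐ θ, HasFDerivAt (fun θ => dofFD A m y θ ε)
      (innerSL ℝ (gradDofFD A (fun y θ => fderiv ℝ (m y) θ) y θ ε)) θ := by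
  simp only [dofFD_eq]
  filter_upwards [ae_hasFDerivAt_param hm y,
    ae_all_iff.2 fun j : Fin P => ae_hasFDerivAt_param hm (y + ε • EuclideanSpace.single j 1)]
    with θ h0 hj
  have h1 := (HasFDerivAt.fun_sum fun (j : Fin P) (_ : j ∈ Finset.univ) =>
    (innerSL ℝ (ContinuousLinearMap.adjoint A (A (EuclideanSpace.single j 1)))).hasFDerivAt.comp θ
      ((hj j).sub h0)).const_mul (1 / ε)
  refine h1.congr_fderiv ?_
  ext v
  simp [gradDofFD, ContinuousLinearMap.adjoint_inner_left]

lemma isWeakGradient_dofFD (hm : LipschitzWith K (Function.uncurry m))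
    (y : EuclideanSpace ℝ (Fin P)) (ε : ℝ) :
    IsWeakGradient Θ (fun θ => dofFD A m y θ ε)
      (fun θ => gradDofFD A (fun y θ => fderiv ℝ (m y) θ) y θ ε) :=
  isWeakGradient_of_locallyLipschitz (locallyLipschitz_dofFD A hm y ε)
    (ae_hasFDerivAt_dofFD A hm y ε)

lemma isWeakGradient_sureFD (σ : ℝ) (hm : LipschitzWith K (Function.uncurry m))
    (y : EuclideanSpace ℝ (Fin P)) (ε : ℝ) :
    IsWeakGradient Θ (fun θ => sureFD σ A m y θ ε)
      (fun θ => sugar σ A m (fun y θ => fderiv ℝ (m y) θ) y θ ε) := by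
  refine isWeakGradient_of_locallyLipschitz ?_ ?_
  · exact ((locallyLipschitz_norm_sq A hm y y).sub (LocallyLipschitz.const _)).add
      (locallyLipschitz_const_mul (locallyLipschitz_dofFD A hm y ε) _)
  · filter_upwards [ae_hasFDerivAt_param hm y, ae_hasFDerivAt_dofFD A hm y ε] with θ h1 h2
    have h3 := ((hasFDerivAt_norm_sq A (z := y) h1).sub_const (σ ^ 2 *
      LinearMap.trace ℝ (EuclideanSpace ℝ (Fin P))
        ((ContinuousLinearMap.adjoint A) ∘L A).toLinearMap)).add (h2.const_mul (2 * σ ^ 2))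
    refine h3.congr_fderiv ?_
    rw [sugar, map_add, map_smul (innerSL ℝ) (2 * σ ^ 2)]

end Lipschitz

end Parameter

/-! ### Weak gradients of the risk and of the degrees of freedom -/

section RiskAndDof

variable {P M d : ℕ} {Θ : Set (EuclideanSpace ℝ (Fin d))}
  {μ m : EuclideanSpace ℝ (Fin P) → EuclideanSpace ℝ (Fin d) → EuclideanSpace ℝ (Fin P)}
  {K L₁ : ℝ≥0}

lemma norm_le_of_lipschitzWith (h₁ : ∀ θ ∈ Θ, LipschitzWith L₁ (fun y => μ y θ))
    (h₀ : ∀ θ ∈ Θ, μ 0 θ = 0) (y : EuclideanSpace ℝ (Fin P)) {θ : EuclideanSpace ℝ (Fin d)}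
    (hθ : θ ∈ Θ) : ‖μ y θ‖ ≤ L₁ * ‖y‖ := by
  simpa [h₀ θ hθ] using (h₁ θ hθ).norm_sub_le y 0

lemma memLp_obsLaw (σ : ℝ) (μ₀ : EuclideanSpace ℝ (Fin P))
    (h₁ : ∀ θ ∈ Θ, LipschitzWith L₁ (fun y => μ y θ)) (h₀ : ∀ θ ∈ Θ, μ 0 θ = 0)
    {θ : EuclideanSpace ℝ (Fin d)} (hθ : θ ∈ Θ) : MemLp (fun y => μ y θ) 2 (obsLaw σ μ₀) :=
  (memLp_id_obsLaw σ μ₀).of_le_mul (h₁ θ hθ).continuous.aestronglyMeasurable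
    (Eventually.of_forall fun y => norm_le_of_lipschitzWith h₁ h₀ y hθ)

variable (A : EuclideanSpace ℝ (Fin P) →L[ℝ] EuclideanSpace ℝ (Fin M))

/-- A single dominating function is wanted for the integrand and its gradient: the square bounds the
former, the second summand the latter. Square integrability of the Gaussian suffices. -/
lemma integrable_risk_bound (σ : ℝ) (μ₀ : EuclideanSpace ℝ (Fin P)) (a b : ℝ) :
    Integrable (fun y => (a * (b * ‖y‖ + ‖μ₀‖)) ^ 2
      + 2 * (K * (a * a * (b * ‖y‖ + ‖μ₀‖)))) (obsLaw σ μ₀) := by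
  have h : MemLp (fun y : EuclideanSpace ℝ (Fin P) => b * ‖y‖ + ‖μ₀‖) 2 (obsLaw σ μ₀) :=
    ((memLp_id_obsLaw σ μ₀).norm.const_mul b).add (memLp_const _)
  exact (h.const_mul a).integrable_sq.add
    ((((h.integrable one_le_two).const_mul (a * a)).const_mul _).const_mul 2)

lemma norm_param_sub_le (hmμ : ∀ y, ∀ θ ∈ Θ, m y θ = μ y θ)
    (h₁ : ∀ θ ∈ Θ, LipschitzWith L₁ (fun y => μ y θ)) (h₀ : ∀ θ ∈ Θ, μ 0 θ = 0)
    (μ₀ y : EuclideanSpace ℝ (Fin P)) {θ : EuclideanSpace ℝ (Fin d)} (hθ : θ ∈ Θ) :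
    ‖m y θ - μ₀‖ ≤ L₁ * ‖y‖ + ‖μ₀‖ := by
  rw [hmμ y θ hθ]
  exact (norm_sub_le _ _).trans
    (add_le_add (norm_le_of_lipschitzWith h₁ h₀ y hθ) le_rfl)

lemma norm_riskIntegrand_grad_le (hm : LipschitzWith K (Function.uncurry m))
    (hmμ : ∀ y, ∀ θ ∈ Θ, m y θ = μ y θ)
    (h₁ : ∀ θ ∈ Θ, LipschitzWith L₁ (fun y => μ y θ)) (h₀ : ∀ θ ∈ Θ, μ 0 θ = 0)
    (μ₀ y : EuclideanSpace ℝ (Fin P)) {θ : EuclideanSpace ℝ (Fin d)} (hθ : θ ∈ Θ) :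
    ‖(2 : ℝ) • ContinuousLinearMap.adjoint (fderiv ℝ (m y) θ)
        (ContinuousLinearMap.adjoint A (A (m y θ - μ₀)))‖
      ≤ (‖A‖ * (L₁ * ‖y‖ + ‖μ₀‖)) ^ 2 + 2 * (K * (‖A‖ * ‖A‖ * (L₁ * ‖y‖ + ‖μ₀‖))) := by
  rw [norm_smul, Real.norm_ofNat]
  have h := norm_adjoint_adjoint_le A (fderiv ℝ (m y) θ) (m y θ - μ₀)
  have h2 := norm_param_sub_le hmμ h₁ h₀ μ₀ y hθ
  have h3 : ‖fderiv ℝ (m y) θ‖ * (‖A‖ * ‖A‖ * ‖m y θ - μ₀‖)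
      ≤ K * (‖A‖ * ‖A‖ * (L₁ * ‖y‖ + ‖μ₀‖)) := by
    gcongr
    exact norm_fderiv_param_le hm y θ
  linarith [sq_nonneg (‖A‖ * (L₁ * ‖y‖ + ‖μ₀‖))]

lemma aestronglyMeasurable_grad (hm : LipschitzWith K (Function.uncurry m))
    {q : EuclideanSpace ℝ (Fin P) × EuclideanSpace ℝ (Fin d) → EuclideanSpace ℝ (Fin P)}
    (hq : Continuous q) (c : ℝ)
    (ρ : Measure (EuclideanSpace ℝ (Fin P) × EuclideanSpace ℝ (Fin d))) :
    AEStronglyMeasurable (fun p => c • ContinuousLinearMap.adjoint (fderiv ℝ (m p.1) p.2)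
        (ContinuousLinearMap.adjoint A (A (q p)))) ρ :=
  (aestronglyMeasurable_adjoint_apply (measurable_fderiv_param hm).aestronglyMeasurable
    ((ContinuousLinearMap.adjoint A).continuous.comp
      (A.continuous.comp hq)).aestronglyMeasurable).const_smul c

variable {Ω : Type*} [MeasurableSpace Ω] {Pr : Measure Ω} {σ : ℝ}
  {W : Ω → EuclideanSpace ℝ (Fin P)}

lemma risk_eq (hW : HasLaw W (multivariateGaussian 0 (σ ^ 2 • (1 : Matrix (Fin P) (Fin P) ℝ))) Pr)
    (μ₀ : EuclideanSpace ℝ (Fin P)) {θ : EuclideanSpace ℝ (Fin d)}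
    (hμ : Continuous fun y => μ y θ) :
    risk Pr W A μ μ₀ θ = ∫ y, ‖A (μ y θ - μ₀)‖ ^ 2 ∂(obsLaw σ μ₀) :=
  (hasLaw_obsLaw hW μ₀).integral_comp (f := fun y => ‖A (μ y θ - μ₀)‖ ^ 2)
    (Continuous.aestronglyMeasurable (by fun_prop))

lemma isWeakGradient_risk (hΘ : IsOpen Θ)
    (hW : HasLaw W (multivariateGaussian 0 (σ ^ 2 • (1 : Matrix (Fin P) (Fin P) ℝ))) Pr)
    (μ₀ : EuclideanSpace ℝ (Fin P)) (hm : LipschitzWith K (Function.uncurry m))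
    (hmμ : ∀ y, ∀ θ ∈ Θ, m y θ = μ y θ)
    (h₁ : ∀ θ ∈ Θ, LipschitzWith L₁ (fun y => μ y θ)) (h₀ : ∀ θ ∈ Θ, μ 0 θ = 0) :
    IsWeakGradient Θ (risk Pr W A μ μ₀) (fun θ => ∫ y, (2 : ℝ) •
      ContinuousLinearMap.adjoint (fderiv ℝ (m y) θ)
        (ContinuousLinearMap.adjoint A (A (m y θ - μ₀))) ∂(obsLaw σ μ₀)) := by
  have hmc : Continuous fun p : EuclideanSpace ℝ (Fin P) × EuclideanSpace ℝ (Fin d) =>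
    m p.1 p.2 := hm.continuous
  refine IsWeakGradient.congr (isWeakGradient_integral hΘ
    (f := fun y θ => ‖A (m y θ - μ₀)‖ ^ 2)
    (g := fun y θ => (2 : ℝ) • ContinuousLinearMap.adjoint (fderiv ℝ (m y) θ)
      (ContinuousLinearMap.adjoint A (A (m y θ - μ₀))))
    (Continuous.aestronglyMeasurable (by unfold Function.uncurry; fun_prop))
    (aestronglyMeasurable_grad A hm (hmc.sub continuous_const) 2 _)
    (integrable_risk_bound (K := K) σ μ₀ ‖A‖ L₁) (fun y θ hθ => ?_)
    (fun y θ hθ => norm_riskIntegrand_grad_le A hm hmμ h₁ h₀ μ₀ y hθ)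
    (Eventually.of_forall fun y => isWeakGradient_norm_sq A hm y μ₀)) ?_ (ae_eq_refl _)
  · have h2 : ‖A (m y θ - μ₀)‖ ≤ ‖A‖ * (L₁ * ‖y‖ + ‖μ₀‖) :=
      (A.le_opNorm _).trans (by gcongr; exact norm_param_sub_le hmμ h₁ h₀ μ₀ y hθ)
    rw [norm_pow, norm_norm]
    have h3 : 0 ≤ 2 * (K * (‖A‖ * ‖A‖ * (L₁ * ‖y‖ + ‖μ₀‖))) := by positivity
    have h4 : ‖A (m y θ - μ₀)‖ ^ 2 ≤ (‖A‖ * (L₁ * ‖y‖ + ‖μ₀‖)) ^ 2 := by gcongr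
    linarith
  · filter_upwards [ae_restrict_mem hΘ.measurableSet] with θ hθ
    rw [risk_eq A hW μ₀ (h₁ θ hθ).continuous]
    simp only [hmμ _ θ hθ]

/-- A covariance needs only one centred factor. Centring Y leaves an expression linear in `μ`, so
differentiation in θ acts on `μ` alone. -/
lemma dof_eq (hW : HasLaw W (multivariateGaussian 0 (σ ^ 2 • (1 : Matrix (Fin P) (Fin P) ℝ))) Pr)
    (μ₀ : EuclideanSpace ℝ (Fin P)) {θ : EuclideanSpace ℝ (Fin d)}
    (hμ : MemLp (fun y => μ y θ) 2 (obsLaw σ μ₀)) :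
    dof Pr W σ A μ μ₀ θ
      = ∫ y, (σ ^ 2)⁻¹ * inner ℝ (A (y - μ₀)) (A (μ y θ)) ∂(obsLaw σ μ₀) := by
  have hid := memLp_id_obsLaw σ μ₀
  have hX : ∀ i, MemLp (fun y => A (y - μ₀) i) 2 (obsLaw σ μ₀) := fun i =>
    (EuclideanSpace.proj (𝕜 := ℝ) i ∘L A).comp_memLp' (hid.sub (memLp_const μ₀))
  have hX' : ∀ i, MemLp (fun y => A y i) 2 (obsLaw σ μ₀) := fun i =>
    (EuclideanSpace.proj (𝕜 := ℝ) i ∘L A).comp_memLp' hid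
  have hZ : ∀ i, MemLp (fun y => A (μ y θ) i) 2 (obsLaw σ μ₀) := fun i =>
    (EuclideanSpace.proj (𝕜 := ℝ) i ∘L A).comp_memLp' hμ
  have hcov : ∀ i, cov[fun ω => A (μ₀ + W ω) i, fun ω => A (μ (μ₀ + W ω) θ) i; Pr]
      = ∫ y, A (y - μ₀) i * A (μ y θ) i ∂(obsLaw σ μ₀) := by
    intro i
    rw [(hasLaw_obsLaw hW μ₀).covariance_fun_comp (f := fun y => A y i)
      (g := fun y => A (μ y θ) i) (hX' i).1.aemeasurable (hZ i).1.aemeasurable]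
    have hmean : ∫ y, A (y - μ₀) i ∂(obsLaw σ μ₀) = 0 := by
      have h1 := (EuclideanSpace.proj (𝕜 := ℝ) i ∘L A).integral_comp_comm
        ((hid.sub (memLp_const μ₀)).integrable one_le_two)
      have h2 : ∫ y, (y - μ₀) ∂(obsLaw σ μ₀) = 0 := by
        rw [integral_sub (hid.integrable one_le_two) (integrable_const _), integral_id_obsLaw]
        simp
      simp only [Pi.sub_apply, h2, map_zero] at h1
      exact h1
    have hsub : (fun y => A y i) = fun y => A (y - μ₀) i + A μ₀ i := by
      ext y
      simp
    rw [hsub, covariance_add_const_left ((hX i).integrable one_le_two),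
      covariance_eq_sub (hX i) (hZ i), hmean, zero_mul, sub_zero]
    rfl
  simp only [dof, hcov]
  rw [integral_const_mul]
  simp only [PiLp.inner_apply]
  rw [integral_finsetSum _ fun i _ => ?_, Finset.mul_sum]
  · refine Finset.sum_congr rfl fun i _ => ?_
    rw [div_eq_inv_mul]
    simp [mul_comm]
  · have h : Integrable (fun y => A (y - μ₀) i * A (μ y θ) i) (obsLaw σ μ₀) :=
      (hX i).integrable_mul (hZ i)
    simpa [mul_comm] using h

/-- The derivative is bounded by `K` alone; the term `L₁ * ‖y‖` is added so that the same function
also dominates the integrand. -/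
lemma norm_dofIntegrand_grad_le (hm : LipschitzWith K (Function.uncurry m))
    (c : ℝ) (μ₀ y : EuclideanSpace ℝ (Fin P)) (θ : EuclideanSpace ℝ (Fin d)) :
    ‖c • ContinuousLinearMap.adjoint (fderiv ℝ (m y) θ)
        (ContinuousLinearMap.adjoint A (A (y - μ₀)))‖
      ≤ |c| * (‖A‖ * ‖A‖) * (‖y - μ₀‖ * (L₁ * ‖y‖ + K)) := by
  rw [norm_smul, Real.norm_eq_abs]
  have h := norm_adjoint_adjoint_le A (fderiv ℝ (m y) θ) (y - μ₀)
  have h3 : ‖fderiv ℝ (m y) θ‖ * (‖A‖ * ‖A‖ * ‖y - μ₀‖)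
      ≤ (L₁ * ‖y‖ + K) * (‖A‖ * ‖A‖ * ‖y - μ₀‖) := by
    gcongr
    exact (norm_fderiv_param_le hm y θ).trans (le_add_of_nonneg_left (by positivity))
  calc _ ≤ |c| * ((L₁ * ‖y‖ + K) * (‖A‖ * ‖A‖ * ‖y - μ₀‖)) := by
        gcongr
        exact h.trans h3
    _ = _ := by ring

lemma integrable_dof_bound (σ : ℝ) (μ₀ : EuclideanSpace ℝ (Fin P)) (c : ℝ) :
    Integrable (fun y => c * (‖y - μ₀‖ * (L₁ * ‖y‖ + K))) (obsLaw σ μ₀) := by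
  have h1 : MemLp (fun y : EuclideanSpace ℝ (Fin P) => (L₁ : ℝ) * ‖y‖ + K) 2 (obsLaw σ μ₀) :=
    ((memLp_id_obsLaw σ μ₀).norm.const_mul _).add (memLp_const _)
  have h2 : MemLp (fun y : EuclideanSpace ℝ (Fin P) => ‖y - μ₀‖) 2 (obsLaw σ μ₀) :=
    ((memLp_id_obsLaw σ μ₀).sub (memLp_const _)).norm
  exact (h2.integrable_mul h1).const_mul c

lemma isWeakGradient_dof (hΘ : IsOpen Θ)
    (hW : HasLaw W (multivariateGaussian 0 (σ ^ 2 • (1 : Matrix (Fin P) (Fin P) ℝ))) Pr)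
    (μ₀ : EuclideanSpace ℝ (Fin P)) (hm : LipschitzWith K (Function.uncurry m))
    (hmμ : ∀ y, ∀ θ ∈ Θ, m y θ = μ y θ)
    (h₁ : ∀ θ ∈ Θ, LipschitzWith L₁ (fun y => μ y θ)) (h₀ : ∀ θ ∈ Θ, μ 0 θ = 0) :
    IsWeakGradient Θ (dof Pr W σ A μ μ₀) (fun θ => ∫ y, (σ ^ 2)⁻¹ •
      ContinuousLinearMap.adjoint (fderiv ℝ (m y) θ)
        (ContinuousLinearMap.adjoint A (A (y - μ₀))) ∂(obsLaw σ μ₀)) := by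
  have hmc : Continuous fun p : EuclideanSpace ℝ (Fin P) × EuclideanSpace ℝ (Fin d) =>
    m p.1 p.2 := hm.continuous
  refine IsWeakGradient.congr (isWeakGradient_integral hΘ
    (f := fun y θ => (σ ^ 2)⁻¹ * inner ℝ (A (y - μ₀)) (A (m y θ)))
    (Continuous.aestronglyMeasurable (by unfold Function.uncurry; fun_prop))
    (aestronglyMeasurable_grad A hm (continuous_fst.sub continuous_const) (σ ^ 2)⁻¹ _)
    (integrable_dof_bound (K := K) (L₁ := L₁) σ μ₀ (|(σ ^ 2)⁻¹| * (‖A‖ * ‖A‖)))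
    (fun y θ hθ => ?_) (fun y θ hθ => norm_dofIntegrand_grad_le A hm _ μ₀ y θ)
    (Eventually.of_forall fun y => isWeakGradient_inner A hm y (y - μ₀) _)) ?_ (ae_eq_refl _)
  · have h2 : ‖A (m y θ)‖ ≤ ‖A‖ * (L₁ * ‖y‖ + K) :=
      (A.le_opNorm _).trans (by
        gcongr
        rw [hmμ y θ hθ]
        exact (norm_le_of_lipschitzWith h₁ h₀ y hθ).trans (le_add_of_nonneg_right K.2))
    have h3 := (norm_inner_le_norm (𝕜 := ℝ) (A (y - μ₀)) (A (m y θ))).trans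
      (mul_le_mul (A.le_opNorm (y - μ₀)) h2 (norm_nonneg _) (by positivity))
    rw [norm_mul, Real.norm_eq_abs]
    calc _ ≤ |(σ ^ 2)⁻¹| * (‖A‖ * ‖y - μ₀‖ * (‖A‖ * (L₁ * ‖y‖ + K))) := by gcongr
      _ = _ := by ring
  · filter_upwards [ae_restrict_mem hΘ.measurableSet] with θ hθ
    rw [dof_eq A hW μ₀ (memLp_obsLaw σ μ₀ h₁ h₀ hθ)]
    simp only [hmμ _ θ hθ]

end RiskAndDof

/-! ### Arbitrary representatives of the weak Jacobian at a fixed θ -/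

section Representatives

variable {P M d : ℕ} {Θ : Set (EuclideanSpace ℝ (Fin d))}
  {μ m : EuclideanSpace ℝ (Fin P) → EuclideanSpace ℝ (Fin d) → EuclideanSpace ℝ (Fin P)}
  {K : ℝ≥0} {J : EuclideanSpace ℝ (Fin P) → EuclideanSpace ℝ (Fin d) →
    (EuclideanSpace ℝ (Fin d) →L[ℝ] EuclideanSpace ℝ (Fin P))}
  {θ : EuclideanSpace ℝ (Fin d)}

lemma aestronglyMeasurable_of_ae_eq_fderiv (hm : LipschitzWith K (Function.uncurry m))
    (h : ∀ᵐ y, J y θ = fderiv ℝ (m y) θ) : AEStronglyMeasurable fun y => J y θ :=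
  ((measurable_fderiv_param hm).comp measurable_prodMk_right).aestronglyMeasurable.congr
    (h.mono fun _ hy => hy.symm)

lemma ae_norm_le_of_ae_eq_fderiv (hm : LipschitzWith K (Function.uncurry m))
    (h : ∀ᵐ y, J y θ = fderiv ℝ (m y) θ) : ∀ᵐ y, ‖J y θ‖ ≤ K :=
  h.mono fun y hy => hy ▸ norm_fderiv_param_le hm y θ

/-- Ball means ignore null sets, so `J y` may be replaced by `fderiv` under the integral, while the
value `J y θ` at the centre must be kept. -/
lemma IsWeakJacobianInParam.ae_tendsto_ballMeasure (hΘ : IsOpen Θ)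
    (hJ : IsWeakJacobianInParam Θ μ J) (hm : LipschitzWith K (Function.uncurry m))
    (hmμ : ∀ y, ∀ θ ∈ Θ, m y θ = μ y θ) (hθ : θ ∈ Θ)
    (hL : ∀ᵐ y, IsLebesguePoint (J y) θ) :
    ∀ᵐ y, Tendsto (fun r : ℝ => ∫ x, ‖fderiv ℝ (m y) x - J y θ‖ ∂(ballMeasure θ r)) (𝓝[>] 0)
      (𝓝 0) := by
  filter_upwards [hL, hJ.ae_eq_fderiv hΘ hm hmμ] with y h1 h2
  refine (isLebesguePoint_iff.1 h1).congr' ?_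
  filter_upwards [eventually_closedBall_subset hΘ hθ] with r hr
  refine integral_congr_ae ?_
  filter_upwards [(ballMeasure_absolutelyContinuous hr.2).ae_le h2] with x hx
  rw [hx]

lemma ae_tendsto_integral_fderiv (hm : LipschitzWith K (Function.uncurry m))
    (h : ∀ᵐ y, Tendsto (fun r : ℝ => ∫ x, ‖fderiv ℝ (m y) x - J y θ‖ ∂(ballMeasure θ r)) (𝓝[>] 0)
      (𝓝 0)) :
    ∀ᵐ y, Tendsto (fun r : ℝ => ∫ x, fderiv ℝ (m y) x ∂(ballMeasure θ r)) (𝓝[>] 0)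
      (𝓝 (J y θ)) := by
  filter_upwards [h] with y hy
  refine tendsto_integral_ballMeasure (Eventually.of_forall fun r => ?_) hy
  exact Integrable.of_bound ((measurable_fderiv ℝ (m y)).aestronglyMeasurable) K
    (Eventually.of_forall fun x => norm_fderiv_param_le hm y x)

/-- Measurability of `J` on the product gives in general no information on one slice in θ; at a
Lebesgue point the slice is an almost everywhere limit of measurable ball means. -/
lemma aestronglyMeasurable_of_tendsto_fderiv (hm : LipschitzWith K (Function.uncurry m))
    (h : ∀ᵐ y, Tendsto (fun r : ℝ => ∫ x, fderiv ℝ (m y) x ∂(ballMeasure θ r)) (𝓝[>] 0)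
      (𝓝 (J y θ))) : AEStronglyMeasurable fun y => J y θ :=
  aestronglyMeasurable_of_tendsto_ae (𝓝[>] (0 : ℝ))
    (fun _ => ((measurable_fderiv_param hm).stronglyMeasurable.integral_prod_right'
      ).aestronglyMeasurable) h

lemma ae_norm_le_of_tendsto_fderiv (hm : LipschitzWith K (Function.uncurry m))
    (h : ∀ᵐ y, Tendsto (fun r : ℝ => ∫ x, fderiv ℝ (m y) x ∂(ballMeasure θ r)) (𝓝[>] 0)
      (𝓝 (J y θ))) : ∀ᵐ y, ‖J y θ‖ ≤ K := by
  filter_upwards [h] with y hy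
  refine le_of_tendsto hy.norm (eventually_mem_nhdsWithin.mono fun r hr => ?_)
  have := isProbabilityMeasure_ballMeasure θ (Set.mem_Ioi.1 hr)
  simpa using norm_integral_le_of_norm_le_const (μ := ballMeasure θ r)
    (Eventually.of_forall fun x => norm_fderiv_param_le hm y x)

variable (A : EuclideanSpace ℝ (Fin P) →L[ℝ] EuclideanSpace ℝ (Fin M))

lemma ae_tendsto_integral_grad (hm : LipschitzWith K (Function.uncurry m))
    (h : ∀ᵐ y, Tendsto (fun r : ℝ => ∫ x, ‖fderiv ℝ (m y) x - J y θ‖ ∂(ballMeasure θ r)) (𝓝[>] 0)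
      (𝓝 0)) {q : EuclideanSpace ℝ (Fin P) → EuclideanSpace ℝ (Fin d) → EuclideanSpace ℝ (Fin P)}
    {C : ℝ≥0} (hq : ∀ y, LipschitzWith C (q y)) (c : ℝ) :
    ∀ᵐ y, Tendsto (fun r : ℝ => ∫ x, c • ContinuousLinearMap.adjoint (fderiv ℝ (m y) x)
        (ContinuousLinearMap.adjoint A (A (q y x))) ∂(ballMeasure θ r)) (𝓝[>] 0)
      (𝓝 (c • ContinuousLinearMap.adjoint (J y θ)
        (ContinuousLinearMap.adjoint A (A (q y θ))))) := by
  filter_upwards [h] with y hy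
  simp only [integral_smul]
  exact (tendsto_integral_adjoint_apply (measurable_fderiv ℝ (m y)).aestronglyMeasurable
    (norm_fderiv_param_le hm y)
    ((ContinuousLinearMap.adjoint A).lipschitz.comp (A.lipschitz.comp (hq y))) hy).const_smul c

/-- Translations by ε eⱼ preserve null sets, and for fixed ε there are finitely many of them. -/
lemma gradDofFD_ae_eq
    {J' : EuclideanSpace ℝ (Fin P) → EuclideanSpace ℝ (Fin d) →
      (EuclideanSpace ℝ (Fin d) →L[ℝ] EuclideanSpace ℝ (Fin P))}
    (h : ∀ᵐ y, J y =ᵐ[volume.restrict Θ] J' y) (ε : ℝ) :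
    ∀ᵐ y, (fun θ => gradDofFD A J y θ ε) =ᵐ[volume.restrict Θ]
      fun θ => gradDofFD A J' y θ ε := by
  have hs : ∀ j : Fin P, ∀ᵐ y, J (y + ε • EuclideanSpace.single j 1) =ᵐ[volume.restrict Θ]
      J' (y + ε • EuclideanSpace.single j 1) := fun j =>
    (measurePreserving_add_right (volume : Measure (EuclideanSpace ℝ (Fin P)))
      (ε • EuclideanSpace.single j 1)).quasiMeasurePreserving.ae h
  filter_upwards [h, ae_all_iff.2 hs] with y h0 h1
  filter_upwards [h0, ae_all_iff.2 h1] with θ h2 h3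
  simp only [gradDofFD, h2, h3]

end Representatives

end Sugar

theorem theorem1 {Ω : Type*} [MeasurableSpace Ω] (Pr : Measure Ω) [IsProbabilityMeasure Pr]
    {P M d : ℕ} (σ : ℝ) (hσ : 0 < σ)
    (W : Ω → EuclideanSpace ℝ (Fin P))
    (hW : HasLaw W (multivariateGaussian 0 (σ ^ 2 • (1 : Matrix (Fin P) (Fin P) ℝ))) Pr)
    (μ₀ : EuclideanSpace ℝ (Fin P))
    (A : EuclideanSpace ℝ (Fin P) →L[ℝ] EuclideanSpace ℝ (Fin M))
    (Θ : Set (EuclideanSpace ℝ (Fin d))) (hΘ : IsOpen Θ)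
    (μ : EuclideanSpace ℝ (Fin P) → EuclideanSpace ℝ (Fin d) → EuclideanSpace ℝ (Fin P))
    (L₁ L₂ : ℝ≥0)
    (hA1 : ∀ θ ∈ Θ, LipschitzWith L₁ (fun y => μ y θ))
    (hA2 : ∀ θ ∈ Θ, μ 0 θ = 0)
    (hA3 : ∀ y, LipschitzOnWith L₂ (μ y) Θ) :
    -- the risk and the DOF are well defined on `Θ` and weakly differentiable there
    (∀ θ ∈ Θ, MemLp (fun ω => μ (μ₀ + W ω) θ) 2 Pr) ∧
    Sugar.IsWeaklyDifferentiable Θ (Sugar.risk Pr W A μ μ₀) ∧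
    Sugar.IsWeaklyDifferentiable Θ (Sugar.dof Pr W σ A μ μ₀) ∧
    -- `μ` has a weak Jacobian `J` with respect to `θ`
    (∃ J, Sugar.IsWeakJacobianInParam Θ μ J) ∧
    -- for every such `J`, the estimators are weak gradients and are asymptotically unbiased
    ∀ J, Sugar.IsWeakJacobianInParam Θ μ J →
      (∀ ε : ℝ, 0 < ε → ∀ᵐ y : EuclideanSpace ℝ (Fin P),
        Sugar.IsWeakGradient Θ (fun θ => Sugar.sureFD σ A μ y θ ε)
          (fun θ => Sugar.sugar σ A μ J y θ ε) ∧
        Sugar.IsWeakGradient Θ (fun θ => Sugar.dofFD A μ y θ ε)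
          (fun θ => Sugar.gradDofFD A J y θ ε)) ∧
      (∀ gR, Sugar.IsWeakGradient Θ (Sugar.risk Pr W A μ μ₀) gR →
        (∀ᵐ θ ∂(volume.restrict Θ), Sugar.ExpectationTendsTo Pr
          (fun ε ω => Sugar.sugar σ A μ J (μ₀ + W ω) θ ε) (gR θ)) ∧
        (∀ θ ∈ Θ, (∀ᵐ y, Sugar.IsLebesguePoint (J y) θ) → Sugar.IsLebesguePoint gR θ →
          Sugar.ExpectationTendsTo Pr
            (fun ε ω => Sugar.sugar σ A μ J (μ₀ + W ω) θ ε) (gR θ))) ∧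
      (∀ gD, Sugar.IsWeakGradient Θ (Sugar.dof Pr W σ A μ μ₀) gD →
        (∀ᵐ θ ∂(volume.restrict Θ), Sugar.ExpectationTendsTo Pr
          (fun ε ω => Sugar.gradDofFD A J (μ₀ + W ω) θ ε) (gD θ)) ∧
        (∀ θ ∈ Θ, (∀ᵐ y, Sugar.IsLebesguePoint (J y) θ) → Sugar.IsLebesguePoint gD θ →
          Sugar.ExpectationTendsTo Pr
            (fun ε ω => Sugar.gradDofFD A J (μ₀ + W ω) θ ε) (gD θ))) := by
  have hΘm := hΘ.measurableSet
  obtain ⟨K, m, hm, hmμ⟩ := Sugar.exists_lipschitzWith_extension hA1 hA3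
  have hY := Sugar.hasLaw_obsLaw hW μ₀
  have hac := Sugar.obsLaw_absolutelyContinuous hσ μ₀
  have hR := Sugar.isWeakGradient_risk A hΘ hW μ₀ hm hmμ hA1 hA2
  have hD := Sugar.isWeakGradient_dof A hΘ hW μ₀ hm hmμ hA1 hA2
  have hmc : Continuous fun p : EuclideanSpace ℝ (Fin P) × EuclideanSpace ℝ (Fin d) =>
    m p.1 p.2 := hm.continuous
  have hμ2 : ∀ θ ∈ Θ, MemLp (fun y => μ y θ) 2 (Sugar.obsLaw σ μ₀) := fun θ hθ =>
    Sugar.memLp_obsLaw σ μ₀ hA1 hA2 hθ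
  refine ⟨fun θ hθ => ?_, ⟨_, hR⟩, ⟨_, hD⟩,
    ⟨_, Sugar.isWeakJacobianInParam_fderiv hΘm hm hmμ⟩, fun J hJ => ⟨fun ε _ => ?_,
      fun gR hgR => ⟨?_, fun θ hθ hL hgL => ?_⟩, fun gD hgD => ⟨?_, fun θ hθ hL hgL => ?_⟩⟩⟩
  · have h := hμ2 θ hθ
    rw [← hY.map_eq] at h
    exact h.comp_of_map hY.aemeasurable
  · have hJm := hJ.ae_eq_fderiv hΘ hm hmμ
    filter_upwards [hJm, Sugar.gradDofFD_ae_eq A hJm ε] with y h1 h2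
    have hdof : ∀ θ ∈ Θ, Sugar.dofFD A m y θ ε = Sugar.dofFD A μ y θ ε := fun θ hθ => by
      simp only [Sugar.dofFD, hmμ _ θ hθ]
    refine ⟨(Sugar.isWeakGradient_sureFD A σ hm y ε).congr ?_ ?_,
      (Sugar.isWeakGradient_dofFD A hm y ε).congr ?_ h2.symm⟩
    · filter_upwards [ae_restrict_mem hΘm] with θ hθ
      simp only [Sugar.sureFD, hdof θ hθ, hmμ _ θ hθ]
    · filter_upwards [ae_restrict_mem hΘm, h1, h2] with θ hθ h3 h4
      simp only [Sugar.sugar, h3, h4, hmμ _ θ hθ]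
    · filter_upwards [ae_restrict_mem hΘm] with θ hθ using hdof θ hθ
  · filter_upwards [hgR.ae_eq hΘ hR, hJ.ae_ae_eq_fderiv hΘ hm hmμ, ae_restrict_mem hΘm]
      with θ h1 h2 hθ
    have h := Sugar.expectationTendsTo_sugar A hσ μ₀ ((hμ2 θ hθ).integrable one_le_two)
      (Sugar.aestronglyMeasurable_of_ae_eq_fderiv hm h2)
      (Sugar.ae_norm_le_of_ae_eq_fderiv hm h2)
    -- The weak gradient is known as an integral of `fderiv`; for this θ it may be rewritten with
    -- `J`, which matches the limit of the expectations.
    rw [h1, integral_congr_ae (g := fun y => (2 : ℝ) • ContinuousLinearMap.adjoint (J y θ)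
      (ContinuousLinearMap.adjoint A (A (μ y θ - μ₀))))]
    · exact h.comp_hasLaw hY
    · filter_upwards [hac.ae_le h2] with y hy
      rw [hy, hmμ y θ hθ]
  · have hlim := hJ.ae_tendsto_ballMeasure hΘ hm hmμ hθ hL
    have hlim' := Sugar.ae_tendsto_integral_fderiv hm hlim
    have h := Sugar.expectationTendsTo_sugar A hσ μ₀ ((hμ2 θ hθ).integrable one_le_two)
      (Sugar.aestronglyMeasurable_of_tendsto_fderiv hm hlim')
      (Sugar.ae_norm_le_of_tendsto_fderiv hm hlim')
    have hgrad := Sugar.ae_tendsto_integral_grad A hm hlim (q := fun y x => m y x - μ₀) (C := K)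
      (fun y => by
        simpa using (Sugar.lipschitzWith_param hm y).sub (LipschitzWith.const μ₀)) 2
    -- `J y θ` may differ from `fderiv ℝ (m y) θ` here, so the value of the gradient is recovered
    -- from means over balls rather than by substitution.
    rw [Sugar.eq_integral_of_isLebesguePoint hΘ
      (Sugar.aestronglyMeasurable_grad A hm (hmc.sub continuous_const) 2 _)
      (Sugar.integrable_risk_bound (K := K) σ μ₀ ‖A‖ L₁)
      (fun y x hx => Sugar.norm_riskIntegrand_grad_le A hm hmμ hA1 hA2 μ₀ y hx)
      (hgR.ae_eq hΘ hR) hθ hgL (hac.ae_le hgrad)]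
    simp only [hmμ _ θ hθ]
    exact h.comp_hasLaw hY
  · filter_upwards [hgD.ae_eq hΘ hD, hJ.ae_ae_eq_fderiv hΘ hm hmμ] with θ h1 h2
    have h := Sugar.expectationTendsTo_gradDofFD A hσ μ₀
      (Sugar.aestronglyMeasurable_of_ae_eq_fderiv hm h2)
      (Sugar.ae_norm_le_of_ae_eq_fderiv hm h2)
    rw [h1, integral_congr_ae (g := fun y => (σ ^ 2)⁻¹ • ContinuousLinearMap.adjoint (J y θ)
      (ContinuousLinearMap.adjoint A (A (y - μ₀))))]
    · exact h.comp_hasLaw hY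
    · filter_upwards [hac.ae_le h2] with y hy
      rw [hy]
  · have hlim := hJ.ae_tendsto_ballMeasure hΘ hm hmμ hθ hL
    have hlim' := Sugar.ae_tendsto_integral_fderiv hm hlim
    have h := Sugar.expectationTendsTo_gradDofFD A hσ μ₀
      (Sugar.aestronglyMeasurable_of_tendsto_fderiv hm hlim')
      (Sugar.ae_norm_le_of_tendsto_fderiv hm hlim')
    -- The vector y - μ₀ does not depend on θ, hence the Lipschitz constant 0.
    have hgrad := Sugar.ae_tendsto_integral_grad A hm hlim (q := fun y _ => y - μ₀) (C := 0)
      (fun y => LipschitzWith.const _) (σ ^ 2)⁻¹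
    rw [Sugar.eq_integral_of_isLebesguePoint hΘ
      (Sugar.aestronglyMeasurable_grad A hm (continuous_fst.sub continuous_const) (σ ^ 2)⁻¹ _)
      (Sugar.integrable_dof_bound (K := K) (L₁ := L₁) σ μ₀ (|(σ ^ 2)⁻¹| * (‖A‖ * ‖A‖)))
      (fun y x _ => Sugar.norm_dofIntegrand_grad_le A hm _ μ₀ y x)
      (hgD.ae_eq hΘ hD) hθ hgL (hac.ae_le hgrad)]
    exact h.comp_hasLaw hY
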